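/- **Setting.** Let $k,m\in\mathbb N$ (positive), $T>0$, $\mathbb F\in\{\mathbb R,\mathbb C\}$. Let $\alpha_1,\dots,\alpha_k\colon\mathbb R\to\mathbb F^{m\times m}$ be continuous and $T$-periodic with $\alpha_k(x)$ invertible for all $x$. Let $\mathcal N\colon\mathbb F^m\times\mathbb R\to\mathbb F^m$, $(u,x)\mapsto\mathcal N(u,x)$, be continuous, $T$-periodic in $x$, twice continuously differentiable (over $\mathbb F$) in $u$, with $\partial_u\mathcal N$ continuous on $\mathbb F^m\times\mathbb R$. For $w\in L^\infty(\mathbb R)$ let $\mathcal L(w)$ be the operator on $L^2(\mathbb R,\mathbb C^m)$ with domain $H^k(\mathbb R)$, $$\mathcal L(w)u=\sum_{i=1}^k\alpha_i\,\partial_x^iu+\partial_u\mathcal N(w,\cdot)\,u .$$ Call $w$ *nondegenerate* if $\mathcal L(w)$ is invertible with bounded inverse, and *strongly spectrally stable* if there is $\varrho>0$ with $\sigma(\mathcal L(w))\subset\{\lambda:\operatorname{Re}\lambda\le-\varrho\}$. A *solution* is a function $u$ with $\sum_{i=1}^k\alpha_i\partial_x^iu+\mathcal N(u,\cdot)=0$.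 Let $M\ge2$, and let $\chi_\pm\colon\mathbb R\to[0,1]$ be a smooth partition of unity, $\chi_-+\chi_+=1$, with $\chi_+$ supported in $(-1,\infty)$ and $\chi_-$ in $(-\infty,1)$. Assume: * (H1) $Z_1,\dots,Z_M\in L^\infty(\mathbb R)$ and $v_{j,\pm}\in H^k_{\mathrm{per}}(0,T)$ satisfy $\chi_\pm(Z_j-v_{j,\pm})\in H^k(\mathbb R)$ for $j=1,\dots,M$; * (H2) $v_{j,+}=v_{j+1,-}$ for $j=1,\dots,M-1$; * (H3) each $Z_j$ is a nondegenerate solution. Let $N\in\mathbb N$. For $n\ge N$ let $\chi_{1,n},\dots,\chi_{M,n}\colon\mathbb R\to[0,1]$ be a smooth partition of unity whose derivatives up to order $k$ are bounded uniformly in $n$, with $\chi_{1,n}$ supported in $(-\infty,\tfrac32nT+1)$, $\chi_{M,n}$ in $((M-\tfrac12)nT-1,\infty)$, and $\chi_{j,n}$ in $((j-\tfrac12)nT-1,(j+\tfrac12)nT+1)$ for $1<j<M$. For $n\ge N$ let $$u_n=a_n+\sum_{j=1}^M\chi_{j,n}\,Z_j(\cdot-jnT),\qquad a_n\in H^k(\mathbb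 R),\qquad \|a_n\|_{H^k}\to0\ \ (n\to\infty),$$ be solutions ($M$-fronts). **Statement.** Suppose that $Z_1,\dots,Z_M$ are strongly spectrally stable and that there is a compact set $\mathcal K\subset\mathbb C$ with $$\sigma(\mathcal L(u_n))\cap\{\lambda:\operatorname{Re}\lambda\ge0\}\subset\mathcal K\qquad\text{for all }n\ge N .$$ Then there is $N_1\ge N$ such that for all $n\ge N_1$ $$\sigma(\mathcal L(u_n))\subset\{\lambda:\operatorname{Re}\lambda<0\},$$ and $u_n$ is strongly spectrally stable whenever $\sigma(\mathcal L(u_n))\cap\{\lambda:\operatorname{Re}\lambda\ge-\delta\}$ is bounded for some $\delta>0$ (which may depend on $n$). -/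

import Mathlib

open MeasureTheory Filter Topology Set
open scoped ContDiff ENNReal

noncomputable section

namespace Multifront

/-! ### Weak derivatives and Sobolev spaces on the line -/

section Sobolev

variable {E : Type*} [NormedAddCommGroup E] [NormedSpace ℝ E]

/-- `g` is the weak derivative on `ℝ` of the locally integrable function `f`. -/
def HasWeakDeriv (f g : ℝ → E) : Prop :=
  LocallyIntegrable f ∧ LocallyIntegrable g ∧
    ∀ φ : ℝ → ℝ, ContDiff ℝ ∞ φ → HasCompactSupport φ →
      ∫ x, φ x • g x = -∫ x, deriv φ x • f x

/-- `d 0 = f` almost everywhere, and `d 1, …, d k` are the weak derivatives of `f` of the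
orders `1, …, k`. -/
def WeakDerivs (k : ℕ) (f : ℝ → E) (d : ℕ → ℝ → E) : Prop :=
  d 0 =ᵐ[volume] f ∧ ∀ i < k, HasWeakDeriv (d i) (d (i + 1))

/-- `f ∈ H^k(ℝ)`. -/
def MemSob (k : ℕ) (f : ℝ → E) : Prop :=
  ∃ d, WeakDerivs k f d ∧ ∀ i ≤ k, MemLp (d i) 2

/-- The `H^k(ℝ)`-norm, `(∑_{i ≤ k} ‖∂ₓⁱ f‖²_{L²})^{1/2}`. Weak derivatives are unique almost
everywhere, so that the infimum is over at most one value; it is `∞` if there are none. -/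
def sobNorm (k : ℕ) (f : ℝ → E) : ℝ≥0∞ :=
  ⨅ (d : ℕ → ℝ → E) (_ : WeakDerivs k f d),
    (∑ i ∈ Finset.range (k + 1), eLpNorm (d i) 2 volume ^ 2) ^ (1 / 2 : ℝ)

/-- `f ∈ H^k_per(0,T)`: `f` is `T`-periodic and its weak derivatives on `ℝ` up to the order `k`
are square integrable over a period. -/
def MemSobPer (k : ℕ) (T : ℝ) (f : ℝ → E) : Prop :=
  Function.Periodic f T ∧
    ∃ d, WeakDerivs k f d ∧ ∀ i ≤ k, MemLp (d i) 2 (volume.restrict (Ioc 0 T))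

theorem HasWeakDeriv.add {f g f' g' : ℝ → E} (h : HasWeakDeriv f g) (h' : HasWeakDeriv f' g') :
    HasWeakDeriv (f + f') (g + g') := by
  refine ⟨h.1.add h'.1, h.2.1.add h'.2.1, fun φ hφ hc => ?_⟩
  have hd : Continuous (deriv φ) := hφ.continuous_deriv (by simp)
  have i1 := h.2.1.integrable_smul_left_of_hasCompactSupport hφ.continuous hc
  have i2 := h'.2.1.integrable_smul_left_of_hasCompactSupport hφ.continuous hc
  have i3 := h.1.integrable_smul_left_of_hasCompactSupport hd hc.deriv
  have i4 := h'.1.integrable_smul_left_of_hasCompactSupport hd hc.deriv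
  simp only [Pi.add_apply, smul_add]
  rw [integral_add i1 i2, integral_add i3 i4, h.2.2 φ hφ hc, h'.2.2 φ hφ hc, neg_add]

theorem HasWeakDeriv.const_smul {𝕂 : Type*} [RCLike 𝕂] [NormedSpace 𝕂 E] [SMulCommClass ℝ 𝕂 E]
    {f g : ℝ → E} (c : 𝕂) (h : HasWeakDeriv f g) : HasWeakDeriv (c • f) (c • g) := by
  refine ⟨h.1.smul c, h.2.1.smul c, fun φ hφ hc => ?_⟩
  simp only [Pi.smul_apply, smul_comm _ c]
  rw [integral_smul, integral_smul, h.2.2 φ hφ hc, smul_neg]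

theorem HasWeakDeriv.ae_unique [CompleteSpace E] {f g f' g' : ℝ → E} (h : HasWeakDeriv f g)
    (h' : HasWeakDeriv f' g') (hf : f =ᵐ[volume] f') : g =ᵐ[volume] g' := by
  refine ae_eq_of_integral_contDiff_smul_eq h.2.1 h'.2.1 fun φ hφ hc => ?_
  rw [h.2.2 φ hφ hc, h'.2.2 φ hφ hc]
  congr 1
  refine integral_congr_ae ?_
  filter_upwards [hf] with x hx
  rw [hx]

theorem WeakDerivs.ae_unique [CompleteSpace E] {k : ℕ} {f : ℝ → E} {d e : ℕ → ℝ → E}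
    (hd : WeakDerivs k f d) (he : WeakDerivs k f e) :
    ∀ i ≤ k, d i =ᵐ[volume] e i := by
  intro i
  induction i with
  | zero => intro _; exact hd.1.trans he.1.symm
  | succ i ih =>
    intro hi
    exact (hd.2 i hi).ae_unique (he.2 i hi) (ih (by omega))

end Sobolev

/-! ### Spectrum of an unbounded operator -/

section Spectrum

variable {H : Type*} [NormedAddCommGroup H] [NormedSpace ℂ H]

/-- `λ` lies in the resolvent set of the unbounded operator `A` if `A - λ` maps the domain of `A`
bijectively onto `H` with a bounded inverse `R`. -/
def resolventSet (A : H →ₗ.[ℂ] H) : Set ℂ :=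
  {l | ∃ R : H →L[ℂ] H,
    (∀ g : H, ∃ hg : R g ∈ A.domain, A ⟨R g, hg⟩ - l • R g = g) ∧
      ∀ u : A.domain, R (A u - l • (u : H)) = u}

/-- The spectrum of the unbounded operator `A`. -/
def spec (A : H →ₗ.[ℂ] H) : Set ℂ := (resolventSet A)ᶜ

end Spectrum

/-! ### The evolution system and its linearization -/

/-- The data of the system `∂ₜu = α_k(x) ∂ₓᵏu + … + α₁(x) ∂ₓu + N(u,x)`, `u(x,t) ∈ 𝕜^m`, with
`T`-periodic coefficients, together with the standing assumptions on them. For `𝕜 = ℂ`,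
derivatives with respect to `u` are complex derivatives. -/
structure PeriodicSystem (𝕜 : Type*) [RCLike 𝕜] (k m : ℕ) (T : ℝ) where
  order_pos : 1 ≤ k
  dim_pos : 1 ≤ m
  period_pos : 0 < T
  α : ℕ → ℝ → Matrix (Fin m) (Fin m) 𝕜
  α_continuous : ∀ i ∈ Finset.Icc 1 k, Continuous (α i)
  α_periodic : ∀ i ∈ Finset.Icc 1 k, Function.Periodic (α i) T
  α_invertible : ∀ x, IsUnit (α k x)
  N : EuclideanSpace 𝕜 (Fin m) → ℝ → EuclideanSpace 𝕜 (Fin m)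
  N_continuous : Continuous fun p : EuclideanSpace 𝕜 (Fin m) × ℝ => N p.1 p.2
  N_contDiff : ∀ x, ContDiff 𝕜 2 fun u => N u x
  N_fderiv_continuous :
    Continuous fun p : EuclideanSpace 𝕜 (Fin m) × ℝ => fderiv 𝕜 (fun u => N u p.2) p.1
  N_periodic : ∀ u, Function.Periodic (N u) T

namespace PeriodicSystem

variable {𝕜 : Type*} [RCLike 𝕜] {k m : ℕ} {T : ℝ} (S : PeriodicSystem 𝕜 k m T)

/-- `u` is a (stationary) solution of `α_k ∂ₓᵏu + … + α₁ ∂ₓu + N(u,x) = 0`. -/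
def IsSolution (u : ℝ → EuclideanSpace 𝕜 (Fin m)) : Prop :=
  ∃ d, WeakDerivs k u d ∧
    ∀ᵐ x, ∑ i ∈ Finset.Icc 1 k, (S.α i x).toEuclideanLin (d i x) + S.N (u x) x = 0

/-- The coefficient `α_i(x)` as a complex matrix. -/
def αC (i : ℕ) (x : ℝ) : Matrix (Fin m) (Fin m) ℂ := (S.α i x).map (RCLike.map 𝕜 ℂ)

/-- The Jacobian matrix `∂_u N(w,x)` as a complex matrix. -/
def jacobianC (w : EuclideanSpace 𝕜 (Fin m)) (x : ℝ) : Matrix (Fin m) (Fin m) ℂ :=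
  Matrix.of fun i j =>
    RCLike.map 𝕜 ℂ ((fderiv 𝕜 (fun u => S.N u x) w (EuclideanSpace.single j 1)).ofLp i)

/-- The linear differential expression `∑ α_i ∂ₓⁱ u + ∂_u N(w(x),x) u`, for given derivatives
`d i = ∂ₓⁱ u`, acting on complex vectors. -/
def linExpr (w : ℝ → EuclideanSpace 𝕜 (Fin m)) (d : ℕ → ℝ → EuclideanSpace ℂ (Fin m)) (x : ℝ) :
    EuclideanSpace ℂ (Fin m) :=
  ∑ i ∈ Finset.Icc 1 k, (S.αC i x).toEuclideanLin (d i x) +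
    (S.jacobianC (w x) x).toEuclideanLin (d 0 x)

/-- The graph of the linearization `ℒ(w)` in `L²(ℝ,ℂ^m) × L²(ℝ,ℂ^m)`: the pairs `(u, ℒ(w)u)`,
`u ∈ H^k(ℝ)`. -/
def linGraph (w : ℝ → EuclideanSpace 𝕜 (Fin m)) :
    Submodule ℂ (Lp (EuclideanSpace ℂ (Fin m)) 2 (volume : Measure ℝ) ×
      Lp (EuclideanSpace ℂ (Fin m)) 2 (volume : Measure ℝ)) where
  carrier := {p | ∃ d : ℕ → ℝ → EuclideanSpace ℂ (Fin m),
    WeakDerivs k p.1 d ∧ (∀ i ≤ k, MemLp (d i) 2) ∧ p.2 =ᵐ[volume] S.linExpr w d}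
  zero_mem' := by
    refine ⟨0, ⟨(Lp.coeFn_zero _ _ _).symm, fun i _ => ?_⟩, fun i _ => MemLp.zero', ?_⟩
    · exact ⟨locallyIntegrable_zero, locallyIntegrable_zero, fun φ _ _ => by simp⟩
    · filter_upwards [Lp.coeFn_zero (EuclideanSpace ℂ (Fin m)) 2 (volume : Measure ℝ)] with x hx
      simp [linExpr]
  add_mem' := by
    rintro ⟨u, g⟩ ⟨u', g'⟩ ⟨d, hd, hm, hg⟩ ⟨d', hd', hm', hg'⟩
    refine ⟨d + d', ⟨?_, fun i hi => (hd.2 i hi).add (hd'.2 i hi)⟩,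
      fun i hi => (hm i hi).add (hm' i hi), ?_⟩
    · exact (hd.1.add hd'.1).trans (Lp.coeFn_add u u').symm
    · filter_upwards [hg, hg', Lp.coeFn_add g g'] with x h1 h2 h3
      simp only [Prod.mk_add_mk, h3, Pi.add_apply, h1, h2, linExpr, map_add,
        Finset.sum_add_distrib]
      abel
  smul_mem' := by
    rintro c ⟨u, g⟩ ⟨d, hd, hm, hg⟩
    refine ⟨c • d, ⟨?_, fun i hi => (hd.2 i hi).const_smul c⟩,
      fun i hi => (hm i hi).const_smul c, ?_⟩
    · exact (hd.1.const_smul c).trans (Lp.coeFn_smul c u).symm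
    · filter_upwards [hg, Lp.coeFn_smul c g] with x h1 h2
      simp only [Prod.smul_mk, h2, Pi.smul_apply, h1, linExpr, map_smul, smul_add,
        Finset.smul_sum]

/-- The unbounded operator `ℒ(w) u = ∑ α_i ∂ₓⁱ u + ∂_u N(w(x),x) u` on `L²(ℝ,ℂ^m)`. For
`w ∈ L^∞(ℝ)` the coefficients are bounded, and its domain is `H^k(ℝ)`. -/
def lin (w : ℝ → EuclideanSpace 𝕜 (Fin m)) :
    Lp (EuclideanSpace ℂ (Fin m)) 2 (volume : Measure ℝ) →ₗ.[ℂ]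
      Lp (EuclideanSpace ℂ (Fin m)) 2 (volume : Measure ℝ) :=
  (S.linGraph w).toLinearPMap

/-- The pairs in `linGraph` do form the graph of an operator. -/
theorem lin_graph (w : ℝ → EuclideanSpace 𝕜 (Fin m)) : (S.lin w).graph = S.linGraph w := by
  refine Submodule.toLinearPMap_graph_eq _ ?_
  rintro ⟨u, g⟩ ⟨d, hd, -, hg⟩ (rfl : u = 0)
  have h0 : WeakDerivs k
      ((0 : Lp (EuclideanSpace ℂ (Fin m)) 2 (volume : Measure ℝ)) : ℝ → EuclideanSpace ℂ (Fin m))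
      (0 : ℕ → ℝ → EuclideanSpace ℂ (Fin m)) :=
    ⟨(Lp.coeFn_zero _ _ _).symm, fun i _ =>
      ⟨locallyIntegrable_zero, locallyIntegrable_zero, fun φ _ _ => by simp⟩⟩
  have hu := hd.ae_unique h0
  have hall : ∀ᵐ x, ∀ i ≤ k, d i x = 0 := by
    rw [ae_all_iff]
    intro i
    by_cases hi : i ≤ k
    · filter_upwards [hu i hi] with x hx _
      simpa using hx
    · exact Eventually.of_forall fun x h => absurd h hi
  refine (Lp.eq_zero_iff_ae_eq_zero).2 ?_
  filter_upwards [hg, hall] with x h1 h2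
  have hsum : ∑ i ∈ Finset.Icc 1 k, (S.αC i x).toEuclideanLin (d i x) = 0 :=
    Finset.sum_eq_zero fun i hi => by rw [h2 i (Finset.mem_Icc.1 hi).2, map_zero]
  rw [h1, linExpr, hsum, h2 0 (Nat.zero_le k), map_zero, add_zero, Pi.zero_apply]

/-- `w` is nondegenerate: `ℒ(w)` is invertible. -/
def Nondegenerate (w : ℝ → EuclideanSpace 𝕜 (Fin m)) : Prop :=
  (0 : ℂ) ∈ resolventSet (S.lin w)

/-- `w` is strongly spectrally stable: for some `ϱ > 0`, the spectrum of `ℒ(w)` lies in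
`{λ : Re λ ≤ -ϱ}`. -/
def StronglySpectrallyStable (w : ℝ → EuclideanSpace 𝕜 (Fin m)) : Prop :=
  ∃ ϱ : ℝ, 0 < ϱ ∧ spec (S.lin w) ⊆ {l : ℂ | l.re ≤ -ϱ}

end PeriodicSystem

/-! ### Fronts, cut-off functions and multifronts -/

/-- A smooth partition of unity `χ₋ + χ₊ = 1` with values in `[0,1]`, where `χ₊` is supported on
`(-1,∞)` and `χ₋` on `(-∞,1)`. -/
structure IsFrontCutoff (χm χp : ℝ → ℝ) : Prop where
  smooth_m : ContDiff ℝ ∞ χm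
  smooth_p : ContDiff ℝ ∞ χp
  mem_m : ∀ x, χm x ∈ Icc (0 : ℝ) 1
  mem_p : ∀ x, χp x ∈ Icc (0 : ℝ) 1
  sum_eq : ∀ x, χm x + χp x = 1
  supp_m : tsupport χm ⊆ Iio 1
  supp_p : tsupport χp ⊆ Ioi (-1)

/-- `Z ∈ L^∞(ℝ)` is a front with the periodic end states `vm` at `-∞` and `vp` at `+∞`. -/
structure IsFront {E : Type*} [NormedAddCommGroup E] [NormedSpace ℝ E] (k : ℕ) (T : ℝ)
    (χm χp : ℝ → ℝ) (Z vm vp : ℝ → E) : Prop where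
  bounded : MemLp Z ∞
  per_m : MemSobPer k T vm
  per_p : MemSobPer k T vp
  tail_m : MemSob k fun x => χm x • (Z x - vm x)
  tail_p : MemSob k fun x => χp x • (Z x - vp x)

/-- A smooth partition of unity `χ 1 + … + χ M = 1` with values in `[0,1]`, where `χ j` is
supported on `((j - 1/2)nT - 1, (j + 1/2)nT + 1)`, the lower end being replaced by `-∞` for
`j = 1` and the upper end by `+∞` for `j = M`. -/
structure IsMultiCutoff (M : ℕ) (T : ℝ) (n : ℕ) (χ : ℕ → ℝ → ℝ) : Prop where
  smooth : ∀ j ∈ Finset.Icc 1 M, ContDiff ℝ ∞ (χ j)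
  mem : ∀ j ∈ Finset.Icc 1 M, ∀ x, χ j x ∈ Icc (0 : ℝ) 1
  sum_eq : ∀ x, ∑ j ∈ Finset.Icc 1 M, χ j x = 1
  supp_lower : ∀ j ∈ Finset.Icc 1 M, j ≠ 1 → tsupport (χ j) ⊆ Ioi (((j : ℝ) - 1 / 2) * n * T - 1)
  supp_upper : ∀ j ∈ Finset.Icc 1 M, j ≠ M → tsupport (χ j) ⊆ Iio (((j : ℝ) + 1 / 2) * n * T + 1)

/-- The formal concatenation `∑_{j=1}^M χ_j Z_j(· - jnT)`. -/
def concatenation {E : Type*} [NormedAddCommGroup E] [NormedSpace ℝ E] (M : ℕ) (T : ℝ) (n : ℕ)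
    (χ : ℕ → ℝ → ℝ) (Z : ℕ → ℝ → E) (x : ℝ) : E :=
  ∑ j ∈ Finset.Icc 1 M, χ j x • Z j (x - j * n * T)

end Multifront

end

/-! Only the compact set `K ∩ {Re ≥ 0}` has to be kept free of spectrum, and strong stability puts
it into the resolvent set of every front.

Resolvents localize. On pieces of length about `nT` the multifront is uniformly close to a translate
of a single front. Translation by a multiple of `T` leaves the coefficients, and hence the norms of
the inverses, unchanged. Cut-off functions varying on the scale `nT` commute with the operator up to
`O(1/(nT))`. So the inverses belonging to the fronts can be glued to an inverse for the multifront,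
with a bound independent of large `n` (`exists_bddInv_of_isGluing`, `eventually_isGluing`,
`exists_eventually_isResolvent`). The lower bound comes from splitting `u = ∑ η_j u` and absorbing
the errors. Surjectivity comes from approximate solutions `∑ ψ_j p_j` together with closedness of
the range, so that no Fredholm theory is needed.

The commutators contain derivatives of `u` up to the order `k - 1`, so the inverses must be
controlled as maps from `L²` to `H^k`; the open mapping theorem provides this
(`exists_bddInv_of_mem_resolventSet`). Uniform closeness of the coefficients rests on boundedness
and decay of `H¹`-functions (`HasWeakDeriv.exists_enorm_le_lintegral` and its consequences).

A resolvent bound at `l` uniform in `n` excludes spectrum from a ball around `l` whose radius does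
not depend on `n`, and finitely many such balls cover the compact set
(`eventually_subset_resolventSet`). Strong stability follows because the spectrum is closed: a
bounded part of it near the imaginary axis is compact and has a largest real part. -/

noncomputable section

namespace Multifront

/-! ### Openness of the resolvent set -/

section Resolvent

variable {H : Type*} [NormedAddCommGroup H] [NormedSpace ℂ H]

/-- `R` is the bounded inverse of `A - l`. -/
def IsResolvent (A : H →ₗ.[ℂ] H) (l : ℂ) (R : H →L[ℂ] H) : Prop :=
  (∀ g : H, ∃ hg : R g ∈ A.domain, A ⟨R g, hg⟩ - l • R g = g) ∧
    ∀ u : A.domain, R (A u - l • (u : H)) = u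

theorem IsResolvent.mem_resolventSet_of_norm_lt [CompleteSpace H] {A : H →ₗ.[ℂ] H} {l z : ℂ}
    {R : H →L[ℂ] H} (hR : IsResolvent A l R) (hz : ‖z - l‖ * ‖R‖ < 1) :
    z ∈ resolventSet A := by
  have hn : ‖(z - l) • R‖ < 1 := by rwa [norm_smul]
  -- On the domain, `A - z = (1 - (z - l) R)(A - l)`. The first factor `U` is inverted by a Neumann
  -- series, so `R U⁻¹` is the resolvent at `z`.
  set U := Units.oneSub ((z - l) • R) hn with hU
  have hUv : (U : H →L[ℂ] H) = 1 - (z - l) • R := rfl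
  have h1 : ∀ g, (U : H →L[ℂ] H) ((↑U⁻¹ : H →L[ℂ] H) g) = g := fun g => by
    rw [← mul_apply_eq_comp, U.mul_inv]; rfl
  have h2 : ∀ g, (↑U⁻¹ : H →L[ℂ] H) ((U : H →L[ℂ] H) g) = g := fun g => by
    rw [← mul_apply_eq_comp, U.inv_mul]; rfl
  refine ⟨R * (↑U⁻¹ : H →L[ℂ] H), fun g => ?_, fun u => ?_⟩
  · obtain ⟨hg, e⟩ := hR.1 ((↑U⁻¹ : H →L[ℂ] H) g)
    refine ⟨hg, ?_⟩
    have h3 := h1 g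
    simp only [hUv, sub_apply, one_apply_eq_self,
      smul_apply] at h3
    simp only [mul_apply_eq_comp]
    rw [sub_eq_iff_eq_add] at e
    rw [e]
    conv_rhs => rw [← h3]
    module
  · have hcomm : Commute R (U : H →L[ℂ] H) := by
      rw [hUv]
      exact (Commute.one_right R).sub_right ((Commute.refl R).smul_right _)
    have hc : R * (↑U⁻¹ : H →L[ℂ] H) = (↑U⁻¹ : H →L[ℂ] H) * R := hcomm.units_inv_right
    rw [hc, mul_apply_eq_comp]
    have h4 : R (A u - z • (u : H)) = (U : H →L[ℂ] H) u := by
      have h5 : A u - z • (u : H) = (A u - l • (u : H)) - (z - l) • (u : H) := by module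
      rw [h5, map_sub, hR.2 u, map_smul]
      simp [hUv]
    rw [h4, h2]

theorem isClosed_spec [CompleteSpace H] (A : H →ₗ.[ℂ] H) : IsClosed (spec A) := by
  rw [spec, isClosed_compl_iff, Metric.isOpen_iff]
  rintro l ⟨R, hR⟩
  refine ⟨1 / (‖R‖ + 1), by positivity, fun z hz => ?_⟩
  refine IsResolvent.mem_resolventSet_of_norm_lt (R := R) hR ?_
  rw [Metric.mem_ball, dist_eq_norm, lt_div_iff₀ (by positivity)] at hz
  nlinarith [norm_nonneg (z - l), norm_nonneg R]

/-- If the resolvents of a family of operators are eventually uniformly bounded at every point of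
a compact set, then this compact set eventually lies in the resolvent sets. -/
theorem eventually_subset_resolventSet [CompleteSpace H] {A : ℕ → H →ₗ.[ℂ] H} {K : Set ℂ}
    (hK : IsCompact K)
    (h : ∀ l ∈ K, ∃ C : ℝ, ∀ᶠ n in atTop, ∃ R : H →L[ℂ] H, IsResolvent (A n) l R ∧ ‖R‖ ≤ C) :
    ∀ᶠ n in atTop, K ⊆ resolventSet (A n) := by
  refine hK.induction_on (p := fun s => ∀ᶠ n in atTop, s ⊆ resolventSet (A n)) (by simp)
    (fun s t hst ht => ht.mono fun n hn => hst.trans hn)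
    (fun s t hs ht => by filter_upwards [hs, ht] with n h1 h2 using union_subset h1 h2) ?_
  intro l hl
  obtain ⟨C, hC⟩ := h l hl
  -- The radius depends on `C` alone, so one ball serves all large `n`; this is where uniformity of
  -- the bound enters.
  refine ⟨Metric.ball l (1 / (|C| + 1)), mem_nhdsWithin_of_mem_nhds
    (Metric.ball_mem_nhds _ (by positivity)), ?_⟩
  filter_upwards [hC] with n ⟨R, hR, hRC⟩ z hz
  refine hR.mem_resolventSet_of_norm_lt ?_
  rw [Metric.mem_ball, dist_eq_norm, lt_div_iff₀ (by positivity)] at hz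
  have := hRC.trans (le_abs_self C)
  nlinarith [norm_nonneg (z - l), norm_nonneg R]

/-- The part of the spectrum in the strip is closed and bounded, hence compact; its maximal real
part is attained and negative, and gives `-ϱ`. If this part is empty, `ϱ = δ` works. -/
theorem exists_spec_subset_of_isBounded [CompleteSpace H] {A : H →ₗ.[ℂ] H}
    (h0 : spec A ⊆ {l : ℂ | l.re < 0}) {δ : ℝ} (hδ : 0 < δ)
    (hb : Bornology.IsBounded (spec A ∩ {l : ℂ | -δ ≤ l.re})) :
    ∃ ϱ : ℝ, 0 < ϱ ∧ spec A ⊆ {l : ℂ | l.re ≤ -ϱ} := by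
  have hcl : IsClosed (spec A ∩ {l : ℂ | -δ ≤ l.re}) :=
    (isClosed_spec A).inter (isClosed_le continuous_const Complex.continuous_re)
  have hcpt : IsCompact (spec A ∩ {l : ℂ | -δ ≤ l.re}) := Metric.isCompact_of_isClosed_isBounded hcl hb
  rcases (spec A ∩ {l : ℂ | -δ ≤ l.re}).eq_empty_or_nonempty with he | hne
  · refine ⟨δ, hδ, fun l hl => ?_⟩
    by_contra hn
    have hn' : -δ < l.re := not_le.1 hn
    exact (eq_empty_iff_forall_notMem.1 he) l ⟨hl, hn'.le⟩
  · obtain ⟨z, hz, hmax⟩ := hcpt.exists_isMaxOn hne Complex.continuous_re.continuousOn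
    refine ⟨-z.re, neg_pos.2 (h0 hz.1), fun l hl => ?_⟩
    simp only [mem_ofPred_eq, neg_neg]
    by_cases hl' : -δ ≤ l.re
    · exact hmax ⟨hl, hl'⟩
    · exact (not_le.1 hl').le.trans hz.2

end Resolvent

/-! ### Pointwise bounds from weak derivatives -/

section Sup

variable {E : Type*} [NormedAddCommGroup E] [NormedSpace ℝ E]

/-- A compactly supported smooth function of mean zero has a compactly supported primitive. -/
theorem exists_primitive_of_integral_eq_zero {ρ : ℝ → ℝ} (hρ : ContDiff ℝ ∞ ρ)
    (hs : Function.support ρ ⊆ Icc (-1) 1) (h0 : ∫ x, ρ x = 0) :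
    ∃ Φ : ℝ → ℝ, ContDiff ℝ ∞ Φ ∧ (∀ x, HasDerivAt Φ (ρ x) x) ∧
      Function.support Φ ⊆ Icc (-1) 1 ∧ ∀ x, |Φ x| ≤ ∫ y, |ρ y| := by
  have hcs : HasCompactSupport ρ :=
    HasCompactSupport.of_support_subset_isCompact isCompact_Icc hs
  have hint : Integrable ρ := hρ.continuous.integrable_of_hasCompactSupport hcs
  have hd : ∀ x, HasDerivAt (fun x => ∫ t in (-1)..x, ρ t) (ρ x) x := fun x =>
    intervalIntegral.integral_hasDerivAt_right (hρ.continuous.intervalIntegrable _ _)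
      hρ.continuous.aestronglyMeasurable.stronglyMeasurableAtFilter hρ.continuous.continuousAt
  refine ⟨fun x => ∫ t in (-1)..x, ρ t, ?_, hd, ?_, fun x => ?_⟩
  · have hderiv : deriv (fun x => ∫ t in (-1)..x, ρ t) = ρ := funext fun x => (hd x).deriv
    exact contDiff_infty_iff_deriv.2 ⟨fun x => (hd x).differentiableAt, by rwa [hderiv]⟩
  · intro x hx
    by_contra hn
    refine hx ?_
    rw [mem_Icc, not_and_or, not_le, not_le] at hn
    rcases hn with hn | hn
    · refine intervalIntegral.integral_zero_ae ?_
      have : ∀ᵐ t : ℝ, t ≠ -1 := by simp [ae_iff]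
      filter_upwards [this] with t ht h
      by_contra hne
      rw [uIoc_of_ge hn.le] at h
      exact ht (le_antisymm h.2 (hs hne).1)
    · have h1 : (∫ t in (-1)..x, ρ t) = ∫ t, ρ t :=
        intervalIntegral.integral_eq_integral_of_support_subset (fun t ht => by
          have h2 := hs ht
          refine ⟨lt_of_le_of_ne h2.1 fun he => ht ?_, h2.2.trans hn.le⟩
          -- The interval integral runs over `Ioc (-1) x`, so the endpoint `-1` must be outside the
          -- support: `ρ` vanishes to its left and is continuous.
          have hz : ∀ s ∈ Iio (-1 : ℝ), ρ s = 0 := fun s hs' => by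
            by_contra hne
            exact absurd (hs hne).1 (not_le.2 hs')
          have hcl : (-1 : ℝ) ∈ closure (Iio (-1 : ℝ)) := by simp
          have hcl' := (isClosed_eq hρ.continuous continuous_const).closure_subset_iff.2
            (fun s hs' => hz s hs') hcl
          rw [← he]
          exact hcl')
      exact h1.trans h0
  · rw [← Real.norm_eq_abs, intervalIntegral.norm_intervalIntegral_eq]
    refine (norm_integral_le_integral_norm _).trans ?_
    exact setIntegral_le_integral hint.norm (Eventually.of_forall fun y => norm_nonneg _)

/-- A function with a weak derivative is bounded, locally, by the `L¹`-norms of the function and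
its weak derivative. -/
theorem HasWeakDeriv.exists_enorm_le_lintegral [CompleteSpace E] :
    ∃ C : ℝ≥0∞, C ≠ ⊤ ∧ ∀ f g : ℝ → E, HasWeakDeriv f g →
      ∀ᵐ x, ‖f x‖ₑ ≤ C * ((∫⁻ y in Icc (x - 1) (x + 1), ‖f y‖ₑ) +
        ∫⁻ y in Icc (x - 1) (x + 1), ‖g y‖ₑ) := by
  -- The mollifications `ρ i * f` converge to `f` almost everywhere. Since `ρ i - ρ 0` has mean
  -- zero, it has a primitive `Φ` supported in `[-1,1]`, and testing with `Φ(x - ·)` gives `(ρ i *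
  -- f)(x) = (ρ 0 * f)(x) + (Φ * g)(x)`. Here `|ρ 0| ≤ B`, and `|Φ| ≤ 2` because both mollifiers
  -- have integral one; hence the constant `B + 2`.
  let φ : ℕ → ContDiffBump (0 : ℝ) := fun i =>
    ⟨1 / (i + 1) / 2, 1 / (i + 1), by positivity, half_lt_self (by positivity)⟩
  let ρ : ℕ → ℝ → ℝ := fun i => (φ i).normed volume
  obtain ⟨B, hB⟩ : ∃ B, ∀ x, ‖ρ 0 x‖ ≤ B :=
    ((φ 0).continuous_normed (μ := volume)).bounded_above_of_compact_support
      (φ 0).hasCompactSupport_normed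
  have hsm : ∀ i, ContDiff ℝ ∞ (ρ i) := fun i => (φ i).contDiff_normed
  have hsupp : ∀ i, Function.support (ρ i) ⊆ Icc (-1) 1 := fun i => by
    rw [(φ i).support_normed_eq, Real.ball_eq_Ioo]
    have : (φ i).rOut ≤ 1 := by
      change 1 / ((i : ℝ) + 1) ≤ 1
      rw [div_le_one (by positivity)]
      linarith [(Nat.cast_nonneg i : (0 : ℝ) ≤ i)]
    intro x hx
    constructor <;> linarith [hx.1, hx.2]
  have hint : ∀ i, Integrable (ρ i) := fun i => (φ i).integrable_normed
  refine ⟨ENNReal.ofReal B + 2, by simp, fun f g hfg => ?_⟩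
  have hlim := ContDiffBump.ae_convolution_tendsto_right_of_locallyIntegrable (φ := φ)
    (l := atTop) (K := 2) (μ := volume) (g := f)
    (tendsto_one_div_add_atTop_nhds_zero_nat (𝕜 := ℝ)) (Eventually.of_forall fun i => by
      change 1 / ((i : ℝ) + 1) ≤ 2 * (1 / (i + 1) / 2)
      linarith) hfg.1
  filter_upwards [hlim] with x hx
  refine le_of_tendsto (hx.enorm) (Eventually.of_forall fun i => ?_)
  obtain ⟨Φ, hΦ, hΦd, hΦs, hΦb⟩ := exists_primitive_of_integral_eq_zero (ρ := fun t => ρ i t - ρ 0 t)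
    ((hsm i).sub (hsm 0)) (fun t ht => by
      by_contra hn
      have h1 : ρ i t = 0 := by
        by_contra h; exact hn (hsupp i h)
      have h2 : ρ 0 t = 0 := by
        by_contra h; exact hn (hsupp 0 h)
      exact ht (by simp [h1, h2])) (by
      rw [integral_sub (hint i) (hint 0)]
      simp [ρ, ContDiffBump.integral_normed])
  have hΦ2 : ∀ t, |Φ t| ≤ 2 := fun t => by
    refine (hΦb t).trans ?_
    have h1 : ∫ y, |ρ i y - ρ 0 y| ≤ ∫ y, (ρ i y + ρ 0 y) := by
      refine integral_mono ((hint i).sub (hint 0)).abs ((hint i).add (hint 0)) fun y => ?_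
      have h2 : 0 ≤ ρ i y := (φ i).nonneg_normed y
      have h3 : 0 ≤ ρ 0 y := (φ 0).nonneg_normed y
      exact abs_sub_le_iff.2 ⟨by linarith, by linarith⟩
    refine h1.trans (le_of_eq ?_)
    rw [integral_add (hint i) (hint 0)]
    simp only [ρ, ContDiffBump.integral_normed]
    norm_num
  have hconv : ∀ j, convolution (ρ j) f (ContinuousLinearMap.lsmul ℝ ℝ) volume x =
      ∫ y, ρ j (x - y) • f y := fun j => by
    rw [convolution_def, ← integral_sub_left_eq_self _ volume x]
    simp
  have hcsub : ∀ ψ : ℝ → ℝ, Function.support ψ ⊆ Icc (-1) 1 →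
      Function.support (fun y => ψ (x - y)) ⊆ Icc (x - 1) (x + 1) := fun ψ hψ y hy => by
    have := hψ (show x - y ∈ Function.support ψ from hy)
    constructor <;> linarith [this.1, this.2]
  have hcs : ∀ ψ : ℝ → ℝ, Function.support ψ ⊆ Icc (-1) 1 →
      HasCompactSupport (fun y => ψ (x - y)) := fun ψ hψ =>
    HasCompactSupport.of_support_subset_isCompact isCompact_Icc (hcsub ψ hψ)
  have hi : ∀ j, Integrable fun y => ρ j (x - y) • f y := fun j =>
    hfg.1.integrable_smul_left_of_hasCompactSupport
      ((hsm j).continuous.comp (continuous_const.sub continuous_id)) (hcs _ (hsupp j))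
  have hbound : ∀ (ψ : ℝ → ℝ) (c : ℝ≥0∞) (h : ℝ → E), c ≠ ⊤ → Function.support ψ ⊆ Icc (-1) 1 →
      (∀ t, ‖ψ t‖ₑ ≤ c) → ‖∫ y, ψ (x - y) • h y‖ₑ ≤ c * ∫⁻ y in Icc (x - 1) (x + 1), ‖h y‖ₑ := by
    intro ψ c h hct hψ hc
    have h1 : ∫ y, ψ (x - y) • h y = ∫ y in Icc (x - 1) (x + 1), ψ (x - y) • h y := by
      refine (setIntegral_eq_integral_of_forall_compl_eq_zero fun y hy => ?_).symm
      have : ψ (x - y) = 0 := by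
        by_contra hne
        exact hy (hcsub ψ hψ hne)
      rw [this, zero_smul]
    rw [h1]
    refine (enorm_integral_le_lintegral_enorm _).trans ?_
    refine le_trans (lintegral_mono fun y => ?_) (lintegral_const_mul' c _ hct).le
    rw [enorm_smul]
    gcongr
    exact hc _
  have htest := hfg.2.2 (fun y => Φ (x - y)) (hΦ.comp (contDiff_const.sub contDiff_id)) (hcs Φ hΦs)
  have hder : deriv (fun y => Φ (x - y)) = fun y => -(ρ i (x - y) - ρ 0 (x - y)) := by
    funext y
    have := (hΦd (x - y)).comp y ((hasDerivAt_id y).const_sub x)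
    rw [Function.comp_def] at this
    simpa using this.deriv
  rw [hder] at htest
  have hdiff : (∫ y, ρ i (x - y) • f y) = (∫ y, ρ 0 (x - y) • f y) + ∫ y, Φ (x - y) • g y := by
    rw [htest, ← integral_neg, ← integral_add (hi 0)]
    · refine integral_congr_ae (Eventually.of_forall fun y => ?_)
      simp only
      module
    · refine ((hi i).sub (hi 0)).congr (Eventually.of_forall fun y => ?_)
      simp only [Pi.sub_apply]
      module
  change ‖convolution (ρ i) f (ContinuousLinearMap.lsmul ℝ ℝ) volume x‖ₑ ≤ _
  rw [hconv, hdiff]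
  refine (enorm_add_le _ _).trans ?_
  have e1 := hbound (ρ 0) (ENNReal.ofReal B) f (by simp) (hsupp 0) fun t => by
    rw [← ofReal_norm]; exact ENNReal.ofReal_le_ofReal (hB t)
  have e2 := hbound Φ 2 g (by simp) hΦs fun t => by
    rw [← ofReal_norm]
    refine (ENNReal.ofReal_le_ofReal (hΦ2 t)).trans (by simp)
  refine (add_le_add e1 e2).trans ?_
  rw [mul_add]
  gcongr
  · exact le_self_add
  · exact le_add_self

/-- Hölder's inequality on an interval of length two contributes the factor `2 ^ (1 / 2)`. Keeping
the norms local is what yields decay at infinity. -/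
theorem HasWeakDeriv.exists_enorm_le_eLpNorm [CompleteSpace E] :
    ∃ C : ℝ≥0∞, C ≠ ⊤ ∧ ∀ f g : ℝ → E, HasWeakDeriv f g →
      ∀ᵐ x, ‖f x‖ₑ ≤ C * (eLpNorm f 2 (volume.restrict (Icc (x - 1) (x + 1))) +
        eLpNorm g 2 (volume.restrict (Icc (x - 1) (x + 1)))) := by
  obtain ⟨C, hC, h⟩ := HasWeakDeriv.exists_enorm_le_lintegral (E := E)
  refine ⟨C * 2 ^ (1 / 2 : ℝ), ENNReal.mul_ne_top hC (by simp), fun f g hfg => ?_⟩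
  have key : ∀ (h : ℝ → E) (x : ℝ), LocallyIntegrable h →
      (∫⁻ y in Icc (x - 1) (x + 1), ‖h y‖ₑ) ≤
        eLpNorm h 2 (volume.restrict (Icc (x - 1) (x + 1))) * 2 ^ (1 / 2 : ℝ) := by
    intro h x hh
    rw [← eLpNorm_one_eq_lintegral_enorm]
    refine (eLpNorm_le_eLpNorm_mul_rpow_measure_univ (p := 1) (q := 2) one_le_two
      hh.aestronglyMeasurable.restrict).trans (le_of_eq ?_)
    congr 1
    simp only [MeasurableSet.univ, Measure.restrict_apply, univ_inter, Real.volume_Icc]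
    norm_num
  filter_upwards [h f g hfg] with x hx
  refine hx.trans ?_
  rw [mul_assoc]
  gcongr
  rw [mul_comm, add_mul]
  exact add_le_add (key f x hfg.1) (key g x hfg.2.1)

theorem HasWeakDeriv.exists_enorm_le [CompleteSpace E] :
    ∃ C : ℝ≥0∞, C ≠ ⊤ ∧ ∀ f g : ℝ → E, HasWeakDeriv f g →
      ∀ᵐ x, ‖f x‖ₑ ≤ C * (eLpNorm f 2 volume + eLpNorm g 2 volume) := by
  obtain ⟨C, hC, h⟩ := HasWeakDeriv.exists_enorm_le_eLpNorm (E := E)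
  refine ⟨C, hC, fun f g hfg => ?_⟩
  filter_upwards [h f g hfg] with x hx
  refine hx.trans ?_
  gcongr <;> exact Measure.restrict_le_self

theorem exists_pos_mul_add_self_le {C : ℝ≥0∞} (hC : C ≠ ⊤) {ε : ℝ} (hε : 0 < ε) :
    ∃ r : ℝ≥0∞, 0 < r ∧ C * (r + r) ≤ ENNReal.ofReal ε := by
  refine ⟨ENNReal.ofReal ε / (2 * (C + 1)), ?_, ?_⟩
  · refine ENNReal.div_pos (by simpa using hε) ?_
    exact ENNReal.mul_ne_top (by simp) (by simp [hC])
  · rw [← two_mul, ← mul_assoc, ← mul_div_assoc]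
    refine ENNReal.div_le_of_le_mul ?_
    calc C * 2 * ENNReal.ofReal ε = ENNReal.ofReal ε * (2 * C) := by ring
      _ ≤ ENNReal.ofReal ε * (2 * (C + 1)) := by gcongr; exact le_self_add

/-- `H¹`-functions decay at infinity. -/
theorem HasWeakDeriv.exists_norm_le_of_le_abs [CompleteSpace E] {f g : ℝ → E} (h : HasWeakDeriv f g)
    (hf : MemLp f 2) (hg : MemLp g 2) {ε : ℝ} (hε : 0 < ε) :
    ∃ R : ℝ, ∀ᵐ x, R ≤ |x| → ‖f x‖ ≤ ε := by
  obtain ⟨C, hC, hb⟩ := HasWeakDeriv.exists_enorm_le_eLpNorm (E := E)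
  obtain ⟨r, hr0, hr⟩ := exists_pos_mul_add_self_le hC hε
  have tail : ∀ φ : ℝ → E, MemLp φ 2 → ∃ R : ℝ, ∀ x, R ≤ |x| →
      eLpNorm φ 2 (volume.restrict (Icc (x - 1) (x + 1))) ≤ r := by
    intro φ hφ
    -- Approximation in `L²` by a compactly supported `ψ`: far out, the interval `[x - 1, x + 1]`
    -- misses the support of `ψ`, and only the approximation error remains.
    obtain ⟨ψ, hψc, hψ, -, -⟩ := hφ.exists_hasCompactSupport_eLpNorm_sub_le (by simp) hr0.ne'
    obtain ⟨R, hR⟩ := hψc.isBounded.subset_closedBall 0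
    refine ⟨R + 2, fun x hx => ?_⟩
    have h1 : eLpNorm φ 2 (volume.restrict (Icc (x - 1) (x + 1))) =
        eLpNorm (φ - ψ) 2 (volume.restrict (Icc (x - 1) (x + 1))) := by
      refine eLpNorm_congr_ae ?_
      filter_upwards [ae_restrict_mem measurableSet_Icc] with y hy
      have : ψ y = 0 := by
        by_contra hne
        have := hR (subset_tsupport ψ hne)
        rw [mem_closedBall_zero_iff, Real.norm_eq_abs] at this
        have h2 : |x| ≤ |y| + |x - y| := by
          have := abs_add_le y (x - y)
          simpa using this
        have h3 : |x - y| ≤ 1 := abs_le.2 ⟨by linarith [hy.1, hy.2], by linarith [hy.1, hy.2]⟩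
        linarith
      simp [this]
    rw [h1]
    exact (eLpNorm_mono_measure _ Measure.restrict_le_self).trans hψ
  obtain ⟨R₁, h₁⟩ := tail f hf
  obtain ⟨R₂, h₂⟩ := tail g hg
  refine ⟨max R₁ R₂, ?_⟩
  filter_upwards [hb f g h] with x hx hxR
  have h3 : ‖f x‖ₑ ≤ ENNReal.ofReal ε := by
    refine hx.trans (le_trans ?_ hr)
    gcongr
    · exact h₁ x ((le_max_left _ _).trans hxR)
    · exact h₂ x ((le_max_right _ _).trans hxR)
  rw [← ofReal_norm] at h3
  exact (ENNReal.ofReal_le_ofReal_iff hε.le).1 h3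

end Sup

/-! ### The Sobolev space as a Banach space -/

theorem HasWeakDeriv.congr_ae {E : Type*} [NormedAddCommGroup E] [NormedSpace ℝ E]
    {f g f' g' : ℝ → E} (h : HasWeakDeriv f g) (hf : f =ᵐ[volume] f') (hg : g =ᵐ[volume] g') :
    HasWeakDeriv f' g' := by
  refine ⟨h.1.congr hf, h.2.1.congr hg, fun φ hφ hc => ?_⟩
  have e1 : ∫ x, φ x • g' x = ∫ x, φ x • g x := integral_congr_ae (by
    filter_upwards [hg] with x hx; rw [hx])
  have e2 : ∫ x, deriv φ x • f' x = ∫ x, deriv φ x • f x := integral_congr_ae (by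
    filter_upwards [hf] with x hx; rw [hx])
  rw [e1, e2, h.2.2 φ hφ hc]

section SobolevSpace

variable {m k : ℕ}

/-- `L²(ℝ, ℂ^m)`. -/
abbrev L2 (m : ℕ) : Type := Lp (EuclideanSpace ℂ (Fin m)) 2 (volume : Measure ℝ)

/-- The space `H^k(ℝ, ℂ^m)`, realized by the tuples `(u, ∂ₓu, …, ∂ₓᵏu)`. -/
def sobSpace (m k : ℕ) : Submodule ℂ (Fin (k + 1) → L2 m) where
  carrier := {v | ∀ i : Fin k, HasWeakDeriv (v i.castSucc : ℝ → EuclideanSpace ℂ (Fin m))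
    (v i.succ)}
  zero_mem' := fun i => by
    have h : HasWeakDeriv (0 : ℝ → EuclideanSpace ℂ (Fin m)) 0 :=
      ⟨locallyIntegrable_zero, locallyIntegrable_zero, fun φ _ _ => by simp⟩
    exact h.congr_ae (Lp.coeFn_zero _ _ _).symm (Lp.coeFn_zero _ _ _).symm
  add_mem' := fun {u v} hu hv i =>
    ((hu i).add (hv i)).congr_ae (Lp.coeFn_add _ _).symm (Lp.coeFn_add _ _).symm
  smul_mem' := fun c v hv i =>
    ((hv i).const_smul c).congr_ae (Lp.coeFn_smul _ _).symm (Lp.coeFn_smul _ _).symm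

/-- For a fixed test function the defining identity is an equation between continuous functionals on
`L²`, and local integrability is automatic there. Closedness makes `H^k` a Banach space, as the open
mapping theorem requires. -/
theorem isClosed_sobSpace : IsClosed (sobSpace m k : Set (Fin (k + 1) → L2 m)) := by
  have hset : (sobSpace m k : Set (Fin (k + 1) → L2 m)) =
      ⋂ i : Fin k, ⋂ φ : {φ : ℝ → ℝ // ContDiff ℝ ∞ φ ∧ HasCompactSupport φ},
        {v | ∫ x, φ.1 x • (v i.succ : ℝ → EuclideanSpace ℂ (Fin m)) x =
          -∫ x, deriv φ.1 x • (v i.castSucc : ℝ → EuclideanSpace ℂ (Fin m)) x} := by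
    ext v
    simp only [mem_iInter]
    constructor
    · intro h i φ
      exact (h i).2.2 φ.1 φ.2.1 φ.2.2
    · intro h i
      exact ⟨(Lp.memLp _).locallyIntegrable one_le_two, (Lp.memLp _).locallyIntegrable one_le_two,
        fun φ hφ hc => h i ⟨φ, hφ, hc⟩⟩
  rw [hset]
  refine isClosed_iInter fun i => isClosed_iInter fun φ => ?_
  have hcont : ∀ ψ : ℝ → ℝ, Continuous ψ → HasCompactSupport ψ → ∀ j : Fin (k + 1),
      Continuous fun v : Fin (k + 1) → L2 m =>
        ∫ x, ψ x • (v j : ℝ → EuclideanSpace ℂ (Fin m)) x := by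
    intro ψ hψ hc j
    have hm : MemLp ψ 2 volume := hψ.memLp_of_hasCompactSupport hc
    have h1 : Continuous fun f : L2 m => ∫ x, ψ x • (f : ℝ → EuclideanSpace ℂ (Fin m)) x := by
      have h2 : (fun f : L2 m => ∫ x, ψ x • (f : ℝ → EuclideanSpace ℂ (Fin m)) x) =
          fun f => ContinuousLinearMap.lpPairing volume 2 2
            (ContinuousLinearMap.lsmul ℝ ℝ (E := EuclideanSpace ℂ (Fin m))) (hm.toLp ψ) f := by
        funext f
        rw [ContinuousLinearMap.lpPairing_eq_integral]
        refine integral_congr_ae ?_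
        filter_upwards [hm.coeFn_toLp] with x hx
        simp [hx]
      rw [h2]
      exact ContinuousLinearMap.continuous _
    exact h1.comp (continuous_apply j)
  exact isClosed_eq (hcont _ φ.2.1.continuous φ.2.2 _)
    (hcont _ (φ.2.1.continuous_deriv (by simp)) φ.2.2.deriv _).neg

instance : CompleteSpace (sobSpace m k) := isClosed_sobSpace.completeSpace_coe

/-- The `i`-th weak derivative of an element of `H^k(ℝ, ℂ^m)`. -/
def wderiv (v : sobSpace m k) (i : ℕ) : ℝ → EuclideanSpace ℂ (Fin m) :=
  if h : i < k + 1 then (v.1 ⟨i, h⟩ : ℝ → EuclideanSpace ℂ (Fin m)) else 0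

theorem wderiv_of_le (v : sobSpace m k) {i : ℕ} (h : i ≤ k) :
    wderiv v i = (v.1 ⟨i, Nat.lt_succ_of_le h⟩ : ℝ → EuclideanSpace ℂ (Fin m)) :=
  dif_pos (Nat.lt_succ_of_le h)

theorem memLp_wderiv (v : sobSpace m k) (i : ℕ) : MemLp (wderiv v i) 2 := by
  unfold wderiv
  split_ifs
  · exact Lp.memLp _
  · exact MemLp.zero'

theorem hasWeakDeriv_wderiv (v : sobSpace m k) {i : ℕ} (h : i < k) :
    HasWeakDeriv (wderiv v i) (wderiv v (i + 1)) := by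
  rw [wderiv_of_le v h.le, wderiv_of_le v h]
  exact v.2 ⟨i, h⟩

theorem weakDerivs_wderiv (v : sobSpace m k) :
    WeakDerivs k (v.1 0 : ℝ → EuclideanSpace ℂ (Fin m)) (wderiv v) :=
  ⟨by rw [wderiv_of_le v (Nat.zero_le k)]; rfl, fun _ h => hasWeakDeriv_wderiv v h⟩

theorem exists_wderiv_ae_eq {d : ℕ → ℝ → EuclideanSpace ℂ (Fin m)}
    (hd : ∀ i < k, HasWeakDeriv (d i) (d (i + 1))) (hm : ∀ i ≤ k, MemLp (d i) 2) :
    ∃ v : sobSpace m k, ∀ i ≤ k, wderiv v i =ᵐ[volume] d i := by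
  refine ⟨⟨fun i => (hm i (Nat.le_of_lt_succ i.2)).toLp (d i), fun i => ?_⟩, fun i hi => ?_⟩
  · exact (hd i i.2).congr_ae (MemLp.coeFn_toLp _).symm (MemLp.coeFn_toLp _).symm
  · rw [wderiv_of_le _ hi]
    exact MemLp.coeFn_toLp (hm i hi)

theorem wderiv_add (u v : sobSpace m k) (i : ℕ) :
    wderiv (u + v) i =ᵐ[volume] wderiv u i + wderiv v i := by
  unfold wderiv
  split_ifs
  · exact Lp.coeFn_add _ _
  · simp

theorem wderiv_smul (c : ℂ) (v : sobSpace m k) (i : ℕ) :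
    wderiv (c • v) i =ᵐ[volume] c • wderiv v i := by
  unfold wderiv
  split_ifs
  · exact Lp.coeFn_smul _ _
  · simp

theorem sobSpace_ext {u v : sobSpace m k} (h : ∀ i ≤ k, wderiv u i =ᵐ[volume] wderiv v i) :
    u = v := by
  refine Subtype.ext (funext fun i => Lp.ext ?_)
  have := h i (Nat.le_of_lt_succ i.2)
  rwa [wderiv_of_le _ (Nat.le_of_lt_succ i.2), wderiv_of_le _ (Nat.le_of_lt_succ i.2)] at this

/-- Weak derivatives are unique, so the tuple is determined by its zeroth entry. -/
theorem sobSpace_ext_zero {u v : sobSpace m k} (h : u.1 0 = v.1 0) : u = v := by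
  refine sobSpace_ext ((weakDerivs_wderiv u).ae_unique (e := wderiv v) ?_)
  rw [h]
  exact weakDerivs_wderiv v

theorem eLpNorm_wderiv_le (v : sobSpace m k) (i : ℕ) :
    eLpNorm (wderiv v i) 2 volume ≤ ENNReal.ofReal ‖v‖ := by
  unfold wderiv
  split_ifs with h
  · rw [← Lp.enorm_def, ← ofReal_norm]
    exact ENNReal.ofReal_le_ofReal (norm_le_pi_norm v.1 ⟨i, h⟩)
  · simp

/-- Turns pointwise estimates of differential expressions into operator bounds. `H^k` carries the
maximum of the `L²`-norms of the derivatives, hence the factor `k + 1`. -/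
theorem norm_le_of_ae_le_sum_wderiv {f : L2 m} {v : sobSpace m k} {c : ℝ} (hc : 0 ≤ c)
    (h : ∀ᵐ x, ‖f x‖ ≤ c * ∑ i ∈ Finset.range (k + 1), ‖wderiv v i x‖) :
    ‖f‖ ≤ c * ((k + 1) * ‖v‖) := by
  have hsum : eLpNorm (fun x => ∑ i ∈ Finset.range (k + 1), ‖wderiv v i x‖) 2 volume ≤
      ENNReal.ofReal ((k + 1) * ‖v‖) := by
    have h1 : (fun x => ∑ i ∈ Finset.range (k + 1), ‖wderiv v i x‖) =
        ∑ i ∈ Finset.range (k + 1), fun x => ‖wderiv v i x‖ := by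
      ext x; simp
    rw [h1]
    refine (eLpNorm_sum_le (fun i _ => (memLp_wderiv v i).1.norm) one_le_two).trans ?_
    refine (Finset.sum_le_sum fun i _ => (eLpNorm_norm _).trans_le (eLpNorm_wderiv_le v i)).trans ?_
    rw [Finset.sum_const, Finset.card_range, nsmul_eq_mul, ENNReal.ofReal_mul (by positivity)]
    gcongr
    rw [ENNReal.ofReal_add (by positivity) zero_le_one]
    simp
  have h2 : eLpNorm f 2 volume ≤ ENNReal.ofReal c * ENNReal.ofReal ((k + 1) * ‖v‖) := by
    refine (eLpNorm_le_mul_eLpNorm_of_ae_le_mul (c := c) ?_ 2).trans (mul_le_mul_right hsum _)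
    filter_upwards [h] with x hx
    rwa [Real.norm_of_nonneg (Finset.sum_nonneg fun i _ => norm_nonneg _)]
  rw [← ENNReal.ofReal_mul hc] at h2
  rw [Lp.norm_def]
  exact ENNReal.toReal_le_of_le_ofReal (by positivity) h2

end SobolevSpace

/-! ### Coefficients -/

/-- A continuous family on a finite-dimensional space, periodic in the last variable, is bounded
over bounded sets. -/
theorem exists_norm_le_of_periodic {V F : Type*} [NormedAddCommGroup V] [ProperSpace V]
    [NormedAddCommGroup F] {G : V → ℝ → F} {T : ℝ} (hT : 0 < T)
    (hG : Continuous fun p : V × ℝ => G p.1 p.2) (hp : ∀ v, Function.Periodic (G v) T) (R : ℝ) :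
    ∃ C : ℝ, ∀ v x, ‖v‖ ≤ R → ‖G v x‖ ≤ C := by
  have hc : IsCompact (Metric.closedBall (0 : V) R ×ˢ Icc 0 T) :=
    (isCompact_closedBall 0 R).prod isCompact_Icc
  obtain ⟨C, hC⟩ := hc.exists_bound_of_continuousOn hG.continuousOn
  refine ⟨C, fun v x hv => ?_⟩
  obtain ⟨y, hy, he⟩ := (hp v).exists_mem_Ico₀ hT x
  rw [he]
  exact hC (v, y) ⟨mem_closedBall_zero_iff.2 hv, hy.1, hy.2.le⟩

/-- A continuous family on a finite-dimensional space, periodic in the last variable, is uniformly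
continuous over bounded sets. -/
theorem exists_norm_sub_le_of_periodic {V F : Type*} [NormedAddCommGroup V] [ProperSpace V]
    [NormedAddCommGroup F] {G : V → ℝ → F} {T : ℝ} (hT : 0 < T)
    (hG : Continuous fun p : V × ℝ => G p.1 p.2) (hp : ∀ v, Function.Periodic (G v) T) (R : ℝ)
    {ε : ℝ} (hε : 0 < ε) :
    ∃ δ : ℝ, 0 < δ ∧ ∀ v w x, ‖v‖ ≤ R → ‖w‖ ≤ R → ‖v - w‖ ≤ δ → ‖G v x - G w x‖ ≤ ε := by
  have hc : IsCompact (Metric.closedBall (0 : V) R ×ˢ Icc 0 T) :=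
    (isCompact_closedBall 0 R).prod isCompact_Icc
  have hu := hc.uniformContinuousOn_of_continuous hG.continuousOn
  rw [Metric.uniformContinuousOn_iff_le] at hu
  obtain ⟨δ, hδ, h⟩ := hu ε hε
  refine ⟨δ, hδ, fun v w x hv hw hvw => ?_⟩
  -- Pairing the two functions moves `x` to the same representative in `[0,T)` for both.
  have hper : Function.Periodic (fun y => (G v y, G w y)) T := fun y => by
    simp only [hp v y, hp w y]
  obtain ⟨y, hy, he⟩ := hper.exists_mem_Ico₀ hT x
  rw [Prod.mk.injEq] at he
  rw [he.1, he.2, ← dist_eq_norm]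
  refine h (v, y) ⟨mem_closedBall_zero_iff.2 hv, hy.1, hy.2.le⟩ (w, y)
    ⟨mem_closedBall_zero_iff.2 hw, hy.1, hy.2.le⟩ ?_
  rw [Prod.dist_eq, dist_self, dist_eq_norm]
  exact max_le hvw hδ.le

theorem aestronglyMeasurable_clm_apply {V W : Type*} [NormedAddCommGroup V] [NormedSpace ℂ V]
    [NormedAddCommGroup W] [NormedSpace ℂ W] {A : ℝ → V →L[ℂ] W} {f : ℝ → V}
    (hA : AEStronglyMeasurable A) (hf : AEStronglyMeasurable f) :
    AEStronglyMeasurable fun x => A x (f x) := by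
  have h : Continuous fun p : (V →L[ℂ] W) × V => p.1 p.2 :=
    (isBoundedBilinearMap_apply (𝕜 := ℂ)).continuous
  exact h.comp_aestronglyMeasurable (hA.prodMk hf)

theorem aestronglyMeasurable_of_continuous_uncurry {V F : Type*} [NormedAddCommGroup V]
    [NormedAddCommGroup F] {G : V → ℝ → F} (hG : Continuous fun p : V × ℝ => G p.1 p.2)
    {w : ℝ → V} (hw : AEStronglyMeasurable w) : AEStronglyMeasurable fun x => G (w x) x :=
  hG.comp_aestronglyMeasurable (hw.prodMk aestronglyMeasurable_id)

namespace PeriodicSystem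

variable {𝕜 : Type*} [RCLike 𝕜] {k m : ℕ} {T : ℝ} (S : PeriodicSystem 𝕜 k m T)

/-- A square matrix as a bounded operator. -/
def matL (m : ℕ) : Matrix (Fin m) (Fin m) ℂ →ₗ[ℂ]
    EuclideanSpace ℂ (Fin m) →L[ℂ] EuclideanSpace ℂ (Fin m) :=
  LinearMap.toContinuousLinearMap.toLinearMap ∘ₗ Matrix.toEuclideanLin.toLinearMap

theorem continuous_matL : Continuous (matL m) := LinearMap.continuous_of_finiteDimensional _

theorem continuous_αC {i : ℕ} (hi : i ∈ Finset.Icc 1 k) : Continuous (S.αC i) :=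
  (S.α_continuous i hi).matrix_map (RCLike.map 𝕜 ℂ).continuous

theorem periodic_αC {i : ℕ} (hi : i ∈ Finset.Icc 1 k) : Function.Periodic (S.αC i) T := fun x => by
  simp only [αC, S.α_periodic i hi x]

theorem continuous_jacobianC :
    Continuous fun p : EuclideanSpace 𝕜 (Fin m) × ℝ => S.jacobianC p.1 p.2 := by
  refine continuous_matrix fun i j => (RCLike.map 𝕜 ℂ).continuous.comp ?_
  have h1 : Continuous fun p : EuclideanSpace 𝕜 (Fin m) × ℝ =>
      fderiv 𝕜 (fun u => S.N u p.2) p.1 (EuclideanSpace.single j 1) :=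
    S.N_fderiv_continuous.clm_apply continuous_const
  exact (PiLp.continuous_apply 2 _ i).comp h1

theorem periodic_jacobianC (w : EuclideanSpace 𝕜 (Fin m)) :
    Function.Periodic (S.jacobianC w) T := fun x => by
  have : (fun u => S.N u (x + T)) = fun u => S.N u x := funext fun u => S.N_periodic u x
  simp only [jacobianC, this]

theorem exists_norm_αC_le : ∃ C : ℝ, 0 ≤ C ∧ ∀ i ∈ Finset.Icc 1 k, ∀ x, ‖matL m (S.αC i x)‖ ≤ C := by
  have h : ∀ i, ∃ C : ℝ, i ∈ Finset.Icc 1 k → ∀ x, ‖matL m (S.αC i x)‖ ≤ C := fun i => by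
    by_cases hi : i ∈ Finset.Icc 1 k
    -- The variable in `V = ℝ` is a dummy, and the radius `0` admits `v = 0`.
    · obtain ⟨C, hC⟩ := exists_norm_le_of_periodic (V := ℝ) (G := fun _ x => matL m (S.αC i x))
        S.period_pos (continuous_matL.comp ((S.continuous_αC hi).comp continuous_snd))
        (fun _ x => by simp only [S.periodic_αC hi x]) 0
      exact ⟨C, fun _ x => hC 0 x (by simp)⟩
    · exact ⟨0, fun h => absurd h hi⟩
  choose C hC using h
  refine ⟨∑ i ∈ Finset.Icc 1 k, |C i|, Finset.sum_nonneg fun i _ => abs_nonneg _, fun i hi x => ?_⟩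
  exact ((hC i hi x).trans (le_abs_self _)).trans
    (Finset.single_le_sum (f := fun i => |C i|) (fun i _ => abs_nonneg _) hi)

theorem exists_norm_jacobianC_le (R : ℝ) :
    ∃ C : ℝ, 0 ≤ C ∧ ∀ w x, ‖w‖ ≤ R → ‖matL m (S.jacobianC w x)‖ ≤ C := by
  obtain ⟨C, hC⟩ := exists_norm_le_of_periodic (G := fun w x => matL m (S.jacobianC w x))
    S.period_pos (continuous_matL.comp S.continuous_jacobianC)
    (fun w x => by simp only [S.periodic_jacobianC w x]) R
  exact ⟨|C|, abs_nonneg _, fun w x hw => (hC w x hw).trans (le_abs_self _)⟩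

theorem exists_norm_jacobianC_sub_le (R : ℝ) {ε : ℝ} (hε : 0 < ε) :
    ∃ δ : ℝ, 0 < δ ∧ ∀ v w x, ‖v‖ ≤ R → ‖w‖ ≤ R → ‖v - w‖ ≤ δ →
      ‖matL m (S.jacobianC v x) - matL m (S.jacobianC w x)‖ ≤ ε :=
  exists_norm_sub_le_of_periodic (G := fun w x => matL m (S.jacobianC w x))
    S.period_pos (continuous_matL.comp S.continuous_jacobianC)
    (fun w x => by simp only [S.periodic_jacobianC w x]) R hε

theorem linExpr_eq (w : ℝ → EuclideanSpace 𝕜 (Fin m)) (d : ℕ → ℝ → EuclideanSpace ℂ (Fin m))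
    (x : ℝ) : S.linExpr w d x = ∑ i ∈ Finset.Icc 1 k, matL m (S.αC i x) (d i x) +
      matL m (S.jacobianC (w x) x) (d 0 x) := rfl

/-- `w ∈ L^∞(ℝ)` up to a constant: an essential bound as a real number. -/
theorem exists_ae_norm_le {E : Type*} [NormedAddCommGroup E] {w : ℝ → E} (hw : MemLp w ⊤) :
    ∃ R : ℝ, ∀ᵐ x, ‖w x‖ ≤ R :=
  ⟨(eLpNorm w ⊤ volume).toReal, by
    filter_upwards [enorm_ae_le_eLpNormEssSup w volume] with x hx
    rw [← toReal_enorm]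
    exact ENNReal.toReal_mono hw.2.ne (by rwa [eLpNorm_exponent_top])⟩

theorem aestronglyMeasurable_linExpr {w : ℝ → EuclideanSpace 𝕜 (Fin m)}
    (hw : AEStronglyMeasurable w) {d : ℕ → ℝ → EuclideanSpace ℂ (Fin m)}
    (hd : ∀ i ≤ k, AEStronglyMeasurable (d i)) : AEStronglyMeasurable (S.linExpr w d) := by
  have e : S.linExpr w d = fun x => ∑ i ∈ Finset.Icc 1 k, matL m (S.αC i x) (d i x) +
      matL m (S.jacobianC (w x) x) (d 0 x) := rfl
  rw [e]
  have h1 : ∀ i ∈ Finset.Icc 1 k, AEStronglyMeasurable fun x => matL m (S.αC i x) (d i x) :=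
    fun i hi => aestronglyMeasurable_clm_apply (A := fun x => matL m (S.αC i x))
      (continuous_matL.comp (S.continuous_αC hi)).aestronglyMeasurable
      (hd i (Finset.mem_Icc.1 hi).2)
  have h2 : AEStronglyMeasurable fun x => matL m (S.jacobianC (w x) x) :=
    aestronglyMeasurable_of_continuous_uncurry (G := fun w x => matL m (S.jacobianC w x))
      (continuous_matL.comp S.continuous_jacobianC) hw
  have h4 : AEStronglyMeasurable fun x => matL m (S.jacobianC (w x) x) (d 0 x) :=
    aestronglyMeasurable_clm_apply h2 (hd 0 (Nat.zero_le k))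
  exact (Finset.aestronglyMeasurable_fun_sum _ h1).add h4

end PeriodicSystem

/-! ### The linearization as a bounded operator on `H^k` -/

namespace PeriodicSystem

variable {𝕜 : Type*} [RCLike 𝕜] {k m : ℕ} {T : ℝ} (S : PeriodicSystem 𝕜 k m T)

theorem norm_linExpr_le {Cα CJ : ℝ} (hα : ∀ i ∈ Finset.Icc 1 k, ∀ x, ‖matL m (S.αC i x)‖ ≤ Cα)
    (hJ0 : 0 ≤ CJ) {w : ℝ → EuclideanSpace 𝕜 (Fin m)} {x : ℝ}
    (hJ : ‖matL m (S.jacobianC (w x) x)‖ ≤ CJ) (hα0 : 0 ≤ Cα)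
    (d : ℕ → ℝ → EuclideanSpace ℂ (Fin m)) :
    ‖S.linExpr w d x‖ ≤ (Cα + CJ) * ∑ i ∈ Finset.range (k + 1), ‖d i x‖ := by
  rw [linExpr_eq, add_mul]
  refine (norm_add_le _ _).trans (add_le_add ?_ ?_)
  · refine (norm_sum_le _ _).trans ?_
    rw [Finset.mul_sum]
    refine (Finset.sum_le_sum fun i hi => (matL m (S.αC i x)).le_of_opNorm_le (hα i hi x) _).trans ?_
    refine Finset.sum_le_sum_of_subset_of_nonneg (fun i hi => ?_) fun i _ _ => by positivity
    rw [Finset.mem_Icc] at hi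
    exact Finset.mem_range.2 (by omega)
  · refine ((matL m (S.jacobianC (w x) x)).le_of_opNorm_le hJ _).trans ?_
    gcongr
    exact Finset.single_le_sum (f := fun i => ‖d i x‖) (fun i _ => norm_nonneg _)
      (Finset.mem_range.2 (Nat.succ_pos k))

theorem linExpr_congr {w : ℝ → EuclideanSpace 𝕜 (Fin m)} {d e : ℕ → ℝ → EuclideanSpace ℂ (Fin m)}
    {x : ℝ} (h : ∀ i ≤ k, d i x = e i x) : S.linExpr w d x = S.linExpr w e x := by
  rw [linExpr_eq, linExpr_eq, h 0 (Nat.zero_le k)]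
  congr 1
  exact Finset.sum_congr rfl fun i hi => by rw [h i (Finset.mem_Icc.1 hi).2]

theorem linExpr_congr_ae {w : ℝ → EuclideanSpace 𝕜 (Fin m)}
    {d e : ℕ → ℝ → EuclideanSpace ℂ (Fin m)} (h : ∀ i ≤ k, d i =ᵐ[volume] e i) :
    ∀ᵐ x, S.linExpr w d x = S.linExpr w e x ∧ d 0 x = e 0 x := by
  have : ∀ᵐ x, ∀ i, i ≤ k → d i x = e i x := by
    rw [ae_all_iff]
    intro i
    by_cases hi : i ≤ k
    · filter_upwards [h i hi] with x hx _ using hx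
    · exact Eventually.of_forall fun x h => absurd h hi
  filter_upwards [this] with x hx
  exact ⟨S.linExpr_congr hx, hx 0 (Nat.zero_le k)⟩

theorem exists_linExpr_bound {w : ℝ → EuclideanSpace 𝕜 (Fin m)} (hw : MemLp w ⊤) (l : ℂ) :
    ∃ C : ℝ, 0 ≤ C ∧ ∀ᵐ x, ∀ d : ℕ → ℝ → EuclideanSpace ℂ (Fin m),
      ‖S.linExpr w d x - l • d 0 x‖ ≤ C * ∑ i ∈ Finset.range (k + 1), ‖d i x‖ := by
  obtain ⟨R, hR⟩ := exists_ae_norm_le hw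
  obtain ⟨Cα, hα0, hα⟩ := S.exists_norm_αC_le
  obtain ⟨CJ, hJ0, hJ⟩ := S.exists_norm_jacobianC_le R
  refine ⟨Cα + CJ + ‖l‖, by positivity, ?_⟩
  filter_upwards [hR] with x hx d
  rw [add_mul _ ‖l‖]
  refine (norm_sub_le _ _).trans (add_le_add (S.norm_linExpr_le hα hJ0 (hJ _ x hx) hα0 d) ?_)
  rw [norm_smul]
  gcongr
  exact Finset.single_le_sum (f := fun i => ‖d i x‖) (fun i _ => norm_nonneg _)
    (Finset.mem_range.2 (Nat.succ_pos k))

theorem memLp_shifted {w : ℝ → EuclideanSpace 𝕜 (Fin m)} (hw : MemLp w ⊤) (l : ℂ)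
    {d : ℕ → ℝ → EuclideanSpace ℂ (Fin m)} (hd : ∀ i ≤ k, MemLp (d i) 2) :
    MemLp (fun x => S.linExpr w d x - l • d 0 x) 2 := by
  obtain ⟨C, -, hC⟩ := S.exists_linExpr_bound hw l
  have hs : MemLp (fun x => ∑ i ∈ Finset.range (k + 1), ‖d i x‖) 2 :=
    memLp_finsetSum _ fun i hi => (hd i (by rw [Finset.mem_range] at hi; omega)).norm
  refine hs.of_le_mul (c := C) ?_ ?_
  · exact (S.aestronglyMeasurable_linExpr hw.1 fun i hi => (hd i hi).1).sub
      ((hd 0 (Nat.zero_le k)).1.const_smul l)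
  · filter_upwards [hC] with x hx
    rw [Real.norm_of_nonneg (Finset.sum_nonneg fun i _ => norm_nonneg _)]
    exact hx d

/-- The operator `ℒ(w) - l` as a linear map from `H^k(ℝ)` to `L²(ℝ)`. -/
def shiftedₗ (w : ℝ → EuclideanSpace 𝕜 (Fin m)) (hw : MemLp w ⊤) (l : ℂ) :
    sobSpace m k →ₗ[ℂ] L2 m where
  toFun v := (S.memLp_shifted hw l (d := wderiv v) fun i _ => memLp_wderiv v i).toLp _
  map_add' u v := by
    rw [← MemLp.toLp_add, MemLp.toLp_eq_toLp_iff]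
    filter_upwards [S.linExpr_congr_ae (w := w) (e := wderiv u + wderiv v)
      fun i _ => wderiv_add u v i] with x hx
    rw [hx.1, hx.2]
    simp only [linExpr_eq, Pi.add_apply, map_add, Finset.sum_add_distrib]
    module
  map_smul' c v := by
    rw [← MemLp.toLp_const_smul, MemLp.toLp_eq_toLp_iff]
    filter_upwards [S.linExpr_congr_ae (w := w) (e := c • wderiv v)
      fun i _ => wderiv_smul c v i] with x hx
    rw [hx.1, hx.2]
    simp only [linExpr_eq, Pi.smul_apply, map_smul, RingHom.id_apply, ← Finset.smul_sum]
    module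

theorem shiftedₗ_ae_eq (w : ℝ → EuclideanSpace 𝕜 (Fin m)) (hw : MemLp w ⊤) (l : ℂ)
    (v : sobSpace m k) : S.shiftedₗ w hw l v =ᵐ[volume]
      fun x => S.linExpr w (wderiv v) x - l • wderiv v 0 x :=
  MemLp.coeFn_toLp (S.memLp_shifted hw l fun i _ => memLp_wderiv v i)

theorem exists_norm_shiftedₗ_le (w : ℝ → EuclideanSpace 𝕜 (Fin m)) (hw : MemLp w ⊤) (l : ℂ) :
    ∃ C : ℝ, ∀ v, ‖S.shiftedₗ w hw l v‖ ≤ C * ‖v‖ := by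
  obtain ⟨C, hC0, hC⟩ := S.exists_linExpr_bound hw l
  refine ⟨C * (k + 1), fun v => ?_⟩
  rw [mul_assoc]
  refine norm_le_of_ae_le_sum_wderiv hC0 ?_
  filter_upwards [hC, S.shiftedₗ_ae_eq w hw l v] with x h1 h2
  rw [h2]
  exact h1 _

/-- The operator `ℒ(w) - l` as a bounded operator from `H^k(ℝ)` to `L²(ℝ)`. -/
def shifted (w : ℝ → EuclideanSpace 𝕜 (Fin m)) (hw : MemLp w ⊤) (l : ℂ) :
    sobSpace m k →L[ℂ] L2 m :=
  (S.shiftedₗ w hw l).mkContinuousOfExistsBound (S.exists_norm_shiftedₗ_le w hw l)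

theorem shifted_ae_eq (w : ℝ → EuclideanSpace 𝕜 (Fin m)) (hw : MemLp w ⊤) (l : ℂ)
    (v : sobSpace m k) : S.shifted w hw l v =ᵐ[volume]
      fun x => S.linExpr w (wderiv v) x - l • wderiv v 0 x :=
  MemLp.coeFn_toLp (S.memLp_shifted hw l fun i _ => memLp_wderiv v i)

/-- With its converse `exists_shifted_of_mem_graph`, this is the dictionary between the unbounded
operator on `L²` and the bounded operator `shifted` on `H^k`. -/
theorem mem_graph_lin_of_shifted {w : ℝ → EuclideanSpace 𝕜 (Fin m)} (hw : MemLp w ⊤) (l : ℂ)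
    (v : sobSpace m k) : (v.1 0, S.shifted w hw l v + l • v.1 0) ∈ (S.lin w).graph := by
  rw [S.lin_graph]
  refine ⟨wderiv v, weakDerivs_wderiv v, fun i _ => memLp_wderiv v i, ?_⟩
  filter_upwards [S.shifted_ae_eq w hw l v, Lp.coeFn_add (S.shifted w hw l v) (l • v.1 0),
    Lp.coeFn_smul l (v.1 0), (weakDerivs_wderiv v).1] with x h1 h2 h3 h4
  change (S.shifted w hw l v + l • v.1 0 : L2 m) x = _
  rw [h2, Pi.add_apply, h1, h3, Pi.smul_apply, h4]
  module

theorem exists_shifted_of_mem_graph {w : ℝ → EuclideanSpace 𝕜 (Fin m)} (hw : MemLp w ⊤) (l : ℂ)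
    {u g : L2 m} (h : (u, g) ∈ (S.lin w).graph) :
    ∃ v : sobSpace m k, v.1 0 = u ∧ S.shifted w hw l v = g - l • u := by
  rw [S.lin_graph] at h
  obtain ⟨d, hd, hm, hg⟩ := h
  obtain ⟨v, hv⟩ := exists_wderiv_ae_eq hd.2 hm
  have h0 : v.1 0 = u :=
    Lp.ext ((weakDerivs_wderiv v).1.symm.trans ((hv 0 (Nat.zero_le k)).trans hd.1))
  refine ⟨v, h0, Lp.ext ?_⟩
  filter_upwards [S.shifted_ae_eq w hw l v, Lp.coeFn_sub g (l • u), Lp.coeFn_smul l u, hg, hd.1,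
    S.linExpr_congr_ae (w := w) hv] with x h1 h2 h3 h4 h5 h6
  rw [h1, h2, Pi.sub_apply, h3, Pi.smul_apply, h6.1, h6.2, ← h5]
  exact congrArg (· - _) h4.symm

/-- `ℒ(w) - l` maps `H^k(ℝ)` onto `L²(ℝ)` with an inverse of norm at most `C`. -/
def BddInv (w : ℝ → EuclideanSpace 𝕜 (Fin m)) (hw : MemLp w ⊤) (l : ℂ) (C : ℝ) : Prop :=
  (∀ v, ‖v‖ ≤ C * ‖S.shifted w hw l v‖) ∧ Function.Surjective (S.shifted w hw l)

/-- The resolvent is only known to be bounded on `L²`, but it makes `shifted` a continuous bijection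
between Banach spaces. The open mapping theorem then bounds the inverse into `H^k`, without any
elliptic estimate. -/
theorem exists_bddInv_of_mem_resolventSet {w : ℝ → EuclideanSpace 𝕜 (Fin m)} (hw : MemLp w ⊤)
    {l : ℂ} (hl : l ∈ resolventSet (S.lin w)) : ∃ C : ℝ, 0 ≤ C ∧ S.BddInv w hw l C := by
  obtain ⟨R, hR1, hR2⟩ := hl
  have hinj : Function.Injective (S.shifted w hw l) := by
    rw [injective_iff_map_eq_zero]
    intro v hv
    have hg := S.mem_graph_lin_of_shifted hw l v
    rw [hv, zero_add, LinearPMap.mem_graph_iff] at hg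
    obtain ⟨y, hy1, hy2⟩ := hg
    have h3 := hR2 y
    rw [hy2] at h3
    simp only [hy1, sub_self, map_zero] at h3
    exact sobSpace_ext_zero h3.symm
  have hsurj : Function.Surjective (S.shifted w hw l) := fun g => by
    obtain ⟨hg, e⟩ := hR1 g
    obtain ⟨v, -, hv⟩ := S.exists_shifted_of_mem_graph hw l ((S.lin w).mem_graph ⟨R g, hg⟩)
    exact ⟨v, hv.trans e⟩
  let e := ContinuousLinearEquiv.ofBijective (S.shifted w hw l) (LinearMap.ker_eq_bot.2 hinj)
    (LinearMap.range_eq_top.2 hsurj)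
  refine ⟨‖(e.symm : L2 m →L[ℂ] sobSpace m k)‖, norm_nonneg _, fun v => ?_, hsurj⟩
  have h := (e.symm : L2 m →L[ℂ] sobSpace m k).le_opNorm (S.shifted w hw l v)
  rwa [ContinuousLinearEquiv.coe_coe, ContinuousLinearEquiv.ofBijective_symm_apply_apply] at h

/-- The resolvent is the inverse followed by the inclusion of `H^k` in `L²`, which does not increase
norms. -/
theorem BddInv.exists_isResolvent {w : ℝ → EuclideanSpace 𝕜 (Fin m)} {hw : MemLp w ⊤}
    {l : ℂ} {C : ℝ} (hC : 0 ≤ C) (h : S.BddInv w hw l C) :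
    ∃ R : L2 m →L[ℂ] L2 m, IsResolvent (S.lin w) l R ∧ ‖R‖ ≤ C := by
  have hinj : Function.Injective (S.shifted w hw l) := by
    rw [injective_iff_map_eq_zero]
    intro v hv
    have := h.1 v
    rw [hv, norm_zero, mul_zero] at this
    exact norm_le_zero_iff.1 this
  let e := LinearEquiv.ofBijective (S.shifted w hw l : sobSpace m k →ₗ[ℂ] L2 m) ⟨hinj, h.2⟩
  have he : ∀ v, e v = S.shifted w hw l v := fun v => rfl
  let R : L2 m →ₗ[ℂ] L2 m :=
    LinearMap.proj (R := ℂ) (φ := fun _ : Fin (k + 1) => L2 m) 0 ∘ₗ (sobSpace m k).subtype ∘ₗ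
      e.symm.toLinearMap
  have hRe : ∀ g, R g = (e.symm g).1 0 := fun g => rfl
  have hRn : ∀ g, ‖R g‖ ≤ C * ‖g‖ := fun g => by
    rw [hRe]
    refine (norm_le_pi_norm (e.symm g).1 0).trans ?_
    have := h.1 (e.symm g)
    rwa [← he, e.apply_symm_apply] at this
  refine ⟨R.mkContinuous C hRn, ⟨fun g => ?_, fun u => ?_⟩, R.mkContinuous_norm_le hC hRn⟩
  · have hg := S.mem_graph_lin_of_shifted hw l (e.symm g)
    rw [← he, e.apply_symm_apply, ← hRe, LinearPMap.mem_graph_iff] at hg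
    obtain ⟨y, hy1, hy2⟩ := hg
    have hy1' : (y : L2 m) = (R.mkContinuous C hRn) g := hy1
    refine ⟨hy1' ▸ y.2, ?_⟩
    have : (⟨(R.mkContinuous C hRn) g, hy1' ▸ y.2⟩ : (S.lin w).domain) = y :=
      Subtype.ext hy1'.symm
    rw [this, hy2, LinearMap.mkContinuous_apply]
    simp
  · obtain ⟨v, hv0, hv⟩ := S.exists_shifted_of_mem_graph hw l ((S.lin w).mem_graph u)
    rw [← hv, LinearMap.mkContinuous_apply, hRe, ← he, e.symm_apply_apply, hv0]

end PeriodicSystem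

/-! ### Multiplication by smooth functions -/

section Leibniz

variable {E : Type*} [NormedAddCommGroup E] [NormedSpace ℝ E]

theorem HasWeakDeriv.zero : HasWeakDeriv (0 : ℝ → E) 0 :=
  ⟨locallyIntegrable_zero, locallyIntegrable_zero, fun φ _ _ => by simp⟩

theorem HasWeakDeriv.sum {ι : Type*} {s : Finset ι} {f g : ι → ℝ → E}
    (h : ∀ i ∈ s, HasWeakDeriv (f i) (g i)) : HasWeakDeriv (∑ i ∈ s, f i) (∑ i ∈ s, g i) := by
  classical
  induction s using Finset.induction_on with
  | empty => simpa using HasWeakDeriv.zero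
  | insert a s ha ih =>
    rw [Finset.sum_insert ha, Finset.sum_insert ha]
    exact (h a (Finset.mem_insert_self _ _)).add
      (ih fun i hi => h i (Finset.mem_insert_of_mem hi))

theorem HasWeakDeriv.smul_smooth {f g : ℝ → E} (h : HasWeakDeriv f g) {η : ℝ → ℝ}
    (hη : ContDiff ℝ ∞ η) :
    HasWeakDeriv (fun x => η x • f x) (fun x => deriv η x • f x + η x • g x) := by
  have hd : Continuous (deriv η) := hη.continuous_deriv (by simp)
  have l1 : LocallyIntegrable fun x => η x • f x := h.1.continuous_smul hη.continuous
  have l2 : LocallyIntegrable fun x => deriv η x • f x := h.1.continuous_smul hd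
  have l3 : LocallyIntegrable fun x => η x • g x := h.2.1.continuous_smul hη.continuous
  refine ⟨l1, l2.add l3, fun φ hφ hc => ?_⟩
  have hφd : Continuous (deriv φ) := hφ.continuous_deriv (by simp)
  have i1 : Integrable fun x => φ x • deriv η x • f x :=
    l2.integrable_smul_left_of_hasCompactSupport hφ.continuous hc
  have i2 : Integrable fun x => φ x • η x • g x :=
    l3.integrable_smul_left_of_hasCompactSupport hφ.continuous hc
  have i3 : Integrable fun x => deriv φ x • η x • f x :=
    l1.integrable_smul_left_of_hasCompactSupport hφd hc.deriv
  have ht := h.2.2 (fun x => φ x * η x) (hφ.mul hη) hc.mul_right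
  have hder : deriv (fun x => φ x * η x) = fun x => deriv φ x * η x + φ x * deriv η x :=
    funext fun x => deriv_fun_mul ((hφ.differentiable (by simp)) x) ((hη.differentiable (by simp)) x)
  rw [hder] at ht
  simp only [add_smul, mul_smul] at ht
  rw [integral_add i3 i1] at ht
  simp only [smul_add]
  rw [integral_add i1 i2, ht]
  abel

/-- The `i`-th derivative of `η f` by the Leibniz rule, for given derivatives `d` of `f`. -/
def leibniz (η : ℝ → ℝ) (d : ℕ → ℝ → E) (i : ℕ) : ℝ → E :=
  ∑ p ∈ Finset.HasAntidiagonal.antidiagonal i, (i.choose p.1 : ℝ) • fun x => iteratedDeriv p.1 η x • d p.2 x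

theorem leibniz_apply (η : ℝ → ℝ) (d : ℕ → ℝ → E) (i : ℕ) (x : ℝ) : leibniz η d i x =
    ∑ p ∈ Finset.HasAntidiagonal.antidiagonal i, (i.choose p.1 : ℝ) • iteratedDeriv p.1 η x • d p.2 x := by
  simp [leibniz]

theorem leibniz_zero (η : ℝ → ℝ) (d : ℕ → ℝ → E) (x : ℝ) : leibniz η d 0 x = η x • d 0 x := by
  simp [leibniz_apply]

theorem contDiff_iteratedDeriv {η : ℝ → ℝ} (hη : ContDiff ℝ ∞ η) (a : ℕ) :
    ContDiff ℝ ∞ (iteratedDeriv a η) := by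
  rw [iteratedDeriv_eq_iterate]
  exact hη.iterate_deriv a

theorem hasWeakDeriv_leibniz {η : ℝ → ℝ} (hη : ContDiff ℝ ∞ η) {d : ℕ → ℝ → E} {i : ℕ}
    (hd : ∀ b ≤ i, HasWeakDeriv (d b) (d (b + 1))) :
    HasWeakDeriv (leibniz η d i) (leibniz η d (i + 1)) := by
  have h : leibniz η d (i + 1) = ∑ p ∈ Finset.HasAntidiagonal.antidiagonal i, (i.choose p.1 : ℝ) •
      fun x => deriv (iteratedDeriv p.1 η) x • d p.2 x + iteratedDeriv p.1 η x • d (p.2 + 1) x := by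
    funext x
    rw [leibniz_apply]
    simp only [Nat.cast_smul_eq_nsmul]
    rw [Finset.sum_antidiagonal_choose_succ_nsmul (fun a b => iteratedDeriv a η x • d b x),
      ← Finset.sum_add_distrib, Finset.sum_apply]
    refine Finset.sum_congr rfl fun p hp => ?_
    rw [Finset.HasAntidiagonal.mem_antidiagonal] at hp
    rw [← Nat.choose_symm_of_eq_add hp.symm]
    simp only [Pi.smul_apply, smul_add, iteratedDeriv_succ]
    abel
  rw [h]
  refine HasWeakDeriv.sum fun p hp => HasWeakDeriv.const_smul _ ?_
  rw [Finset.HasAntidiagonal.mem_antidiagonal] at hp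
  exact (hd p.2 (by omega)).smul_smooth (contDiff_iteratedDeriv hη _)

theorem memLp_leibniz {η : ℝ → ℝ} (hη : ContDiff ℝ ∞ η) {d : ℕ → ℝ → E} {i : ℕ} {B : ℝ}
    (hB : ∀ a ≤ i, ∀ x, |iteratedDeriv a η x| ≤ B) (hd : ∀ b ≤ i, MemLp (d b) 2) :
    MemLp (leibniz η d i) 2 := by
  refine memLp_finsetSum' _ fun p hp => MemLp.const_smul ?_ _
  rw [Finset.HasAntidiagonal.mem_antidiagonal] at hp
  have hdp := hd p.2 (by omega)
  refine hdp.of_le_mul (c := B) ((contDiff_iteratedDeriv hη _).continuous.aestronglyMeasurable.smul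
    hdp.1) (Eventually.of_forall fun x => ?_)
  rw [norm_smul, Real.norm_eq_abs]
  gcongr
  exact hB p.1 (by omega) x

/-- Apart from `η • d i`, every term of the Leibniz sum contains a derivative of `η` of positive
order, and the binomial coefficients add up to at most `2 ^ k`. -/
theorem norm_leibniz_sub_le {η : ℝ → ℝ} {d : ℕ → ℝ → E} {i k : ℕ} (hi : i ≤ k) {ε : ℝ}
    (hε : 0 ≤ ε) {x : ℝ} (hη : ∀ a ∈ Finset.Icc 1 k, |iteratedDeriv a η x| ≤ ε) :
    ‖leibniz η d i x - η x • d i x‖ ≤ 2 ^ k * ε * ∑ b ∈ Finset.range (k + 1), ‖d b x‖ := by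
  have h0 : leibniz η d i x - η x • d i x = ∑ p ∈ (Finset.HasAntidiagonal.antidiagonal i).erase (0, i),
      (i.choose p.1 : ℝ) • iteratedDeriv p.1 η x • d p.2 x := by
    rw [leibniz_apply, ← Finset.add_sum_erase _ _ (show (0, i) ∈ Finset.HasAntidiagonal.antidiagonal i by simp)]
    simp
  set s := ∑ b ∈ Finset.range (k + 1), ‖d b x‖
  have hs : 0 ≤ s := Finset.sum_nonneg fun _ _ => norm_nonneg _
  rw [h0]
  calc _ ≤ ∑ p ∈ (Finset.HasAntidiagonal.antidiagonal i).erase (0, i), (i.choose p.1 : ℝ) * (ε * s) := by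
        refine (norm_sum_le _ _).trans (Finset.sum_le_sum fun p hp => ?_)
        rw [Finset.mem_erase, Finset.HasAntidiagonal.mem_antidiagonal] at hp
        have hp1 : p.1 ≠ 0 := fun h => hp.1 (Prod.ext h (by simpa [h] using hp.2))
        rw [norm_smul, norm_smul, Real.norm_of_nonneg (Nat.cast_nonneg _), Real.norm_eq_abs]
        gcongr
        · exact hη p.1 (Finset.mem_Icc.2 ⟨by omega, by omega⟩)
        · exact Finset.single_le_sum (f := fun b => ‖d b x‖) (fun _ _ => norm_nonneg _)
            (Finset.mem_range.2 (by omega))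
    _ ≤ ∑ p ∈ Finset.HasAntidiagonal.antidiagonal i, (i.choose p.1 : ℝ) * (ε * s) :=
        Finset.sum_le_sum_of_subset_of_nonneg (Finset.erase_subset _ _)
          fun _ _ _ => by positivity
    _ = 2 ^ i * (ε * s) := by
        rw [← Finset.sum_mul, Finset.Nat.sum_antidiagonal_eq_sum_range_succ_mk]
        simp only
        rw [← Nat.cast_sum, Nat.sum_range_choose]
        simp
    _ ≤ 2 ^ k * (ε * s) := by
        gcongr
        norm_num
    _ = _ := by ring

end Leibniz

theorem exists_wderiv_leibniz {k m : ℕ} {η : ℝ → ℝ} (hη : ContDiff ℝ ∞ η) {B : ℝ}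
    (hB : ∀ a ≤ k, ∀ x, |iteratedDeriv a η x| ≤ B) (u : sobSpace m k) :
    ∃ v : sobSpace m k, ∀ i ≤ k, wderiv v i =ᵐ[volume] leibniz η (wderiv u) i :=
  exists_wderiv_ae_eq
    (fun _ hi => hasWeakDeriv_leibniz hη fun _ hb => hasWeakDeriv_wderiv u (hb.trans_lt hi))
    fun _ hi => memLp_leibniz hη (fun a ha => hB a (ha.trans hi)) fun b _ => memLp_wderiv u b

theorem exists_smul_L2 {m : ℕ} {η : ℝ → ℝ} (hη : Continuous η) {B : ℝ}
    (hB : ∀ x, |η x| ≤ B) (g : L2 m) : ∃ f : L2 m, f =ᵐ[volume] (fun x => η x • g x) ∧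
      ‖f‖ ≤ B * ‖g‖ := by
  have h : ∀ x, ‖η x • g x‖ ≤ B * ‖g x‖ := fun x => by
    rw [norm_smul, Real.norm_eq_abs]
    gcongr
    exact hB x
  have hm : MemLp (fun x => η x • g x) 2 := (Lp.memLp g).of_le_mul (c := B)
    (hη.aestronglyMeasurable.smul (Lp.memLp g).1) (Eventually.of_forall h)
  refine ⟨hm.toLp _, hm.coeFn_toLp, Lp.norm_le_mul_norm_of_ae_le_mul ?_⟩
  filter_upwards [hm.coeFn_toLp] with x hx
  rw [hx]
  exact h x

/-! ### Commutators with cut-off functions. -/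

namespace PeriodicSystem

variable {𝕜 : Type*} [RCLike 𝕜] {k m : ℕ} {T : ℝ} (S : PeriodicSystem 𝕜 k m T)

/-- Commuting a slowly varying cut-off function with `ℒ(w) - l`, while exchanging the coefficient
`w` for `w'`, costs a small error. -/
theorem exists_norm_shifted_leibniz_sub_le : ∃ K : ℝ, 0 ≤ K ∧
    ∀ (w w' : ℝ → EuclideanSpace 𝕜 (Fin m)) (hw : MemLp w ⊤) (hw' : MemLp w' ⊤) (l : ℂ) (ε : ℝ)
      (η : ℝ → ℝ), 0 ≤ ε → (∀ x, |η x| ≤ 1) →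
      (∀ a ∈ Finset.Icc 1 k, ∀ x, |iteratedDeriv a η x| ≤ ε) →
      (∀ᵐ x, η x ≠ 0 →
        ‖matL m (S.jacobianC (w' x) x) - matL m (S.jacobianC (w x) x)‖ ≤ ε) →
      ∀ (u v : sobSpace m k) (f : L2 m), (∀ i ≤ k, wderiv v i =ᵐ[volume] leibniz η (wderiv u) i) →
        f =ᵐ[volume] (fun x => η x • S.shifted w hw l u x) →
        ‖S.shifted w' hw' l v - f‖ ≤ K * ε * ‖u‖ := by
  obtain ⟨Cα, hα0, hα⟩ := S.exists_norm_αC_le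
  -- The `k` leading terms contribute `Cα * 2 ^ k` each and the change of Jacobian contributes `1`.
  -- The bound is uniform in `w`, `w'` and `l`.
  refine ⟨(k * (Cα * 2 ^ k) + 1) * (k + 1), by positivity,
    fun w w' hw hw' l ε η hε hη1 hη hclose u v f hv hf => ?_⟩
  have key : ‖S.shifted w' hw' l v - f‖ ≤ ((k * (Cα * 2 ^ k) + 1) * ε) * ((k + 1) * ‖u‖) := by
    refine norm_le_of_ae_le_sum_wderiv (by positivity) ?_
    filter_upwards [S.linExpr_congr_ae (w := w') hv, S.shifted_ae_eq w' hw' l v,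
      S.shifted_ae_eq w hw l u, hf, Lp.coeFn_sub (S.shifted w' hw' l v) f, hclose]
      with x h1 h2 h3 h4 h5 h6
    set d := wderiv u
    set s := ∑ b ∈ Finset.range (k + 1), ‖d b x‖
    have hs : 0 ≤ s := Finset.sum_nonneg fun _ _ => norm_nonneg _
    -- The terms with `l` cancel. What remains is a commutator of the leading part with `η`, and the
    -- difference of the Jacobians, which matters only where `η` does not vanish.
    have e : (S.shifted w' hw' l v - f : L2 m) x =
        ∑ i ∈ Finset.Icc 1 k, matL m (S.αC i x) (leibniz η d i x - η x • d i x) +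
        η x • (matL m (S.jacobianC (w' x) x) - matL m (S.jacobianC (w x) x)) (d 0 x) := by
      rw [h5, Pi.sub_apply, h2, h4, h3, h1.1, h1.2, linExpr_eq, linExpr_eq, leibniz_zero]
      have hr : ∀ (A : EuclideanSpace ℂ (Fin m) →L[ℂ] EuclideanSpace ℂ (Fin m)) (c : ℝ)
          (y : EuclideanSpace ℂ (Fin m)), A (c • y) = c • A y := fun A c y => A.map_smul_of_tower c y
      simp only [map_sub, Finset.sum_sub_distrib, sub_apply, smul_sub, smul_add, Finset.smul_sum,
        hr]
      rw [smul_comm l (η x)]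
      abel
    rw [e, add_mul, add_mul]
    refine (norm_add_le _ _).trans (add_le_add ?_ ?_)
    · refine (norm_sum_le _ _).trans ?_
      have hterm : ∀ i ∈ Finset.Icc 1 k,
          ‖matL m (S.αC i x) (leibniz η d i x - η x • d i x)‖ ≤ Cα * (2 ^ k * ε * s) := by
        intro i hi
        refine ((matL m (S.αC i x)).le_of_opNorm_le (hα i hi x) _).trans ?_
        gcongr
        exact norm_leibniz_sub_le (Finset.mem_Icc.1 hi).2 hε fun a ha => hη a ha x
      refine (Finset.sum_le_sum hterm).trans (le_of_eq ?_)
      rw [Finset.sum_const, Nat.card_Icc, nsmul_eq_mul, Nat.add_sub_cancel]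
      ring
    · rw [one_mul]
      by_cases hx : η x = 0
      · rw [hx, zero_smul, norm_zero]
        positivity
      · rw [norm_smul, Real.norm_eq_abs]
        calc _ ≤ 1 * (ε * ‖d 0 x‖) := by
              gcongr
              · exact hη1 x
              · exact ContinuousLinearMap.le_of_opNorm_le _ (h6 hx) _
          _ ≤ ε * s := by
              rw [one_mul]
              gcongr
              exact Finset.single_le_sum (f := fun b => ‖d b x‖) (fun _ _ => norm_nonneg _)
                (Finset.mem_range.2 (Nat.succ_pos k))
  calc _ ≤ _ := key
    _ = _ := by ring

/-! ### Translations -/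

theorem norm_eq_of_ae_eq_comp_add {f g : L2 m} {s : ℝ}
    (h : f =ᵐ[volume] fun x => g (x + s)) : ‖f‖ = ‖g‖ := by
  rw [Lp.norm_def, Lp.norm_def, eLpNorm_congr_ae h]
  congr 1
  exact eLpNorm_comp_measurePreserving (Lp.memLp g).1 (measurePreserving_add_right volume s)

theorem ae_comp_add {p : ℝ → Prop} (h : ∀ᵐ x, p x) (s : ℝ) : ∀ᵐ x : ℝ, p (x + s) :=
  (measurePreserving_add_right volume s).quasiMeasurePreserving.ae h

theorem _root_.Multifront.HasWeakDeriv.comp_add {E : Type*} [NormedAddCommGroup E]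
    [NormedSpace ℝ E] {f g : ℝ → E}
    (h : HasWeakDeriv f g) (s : ℝ) : HasWeakDeriv (fun x => f (x + s)) (fun x => g (x + s)) := by
  have hloc : ∀ f : ℝ → E, LocallyIntegrable f → LocallyIntegrable fun x => f (x + s) := by
    intro f hf
    rw [locallyIntegrable_iff] at hf ⊢
    intro K hK
    have h1 := hf _ (hK.image (continuous_add_const s))
    rwa [(measurePreserving_add_right volume s).integrableOn_image
      (Homeomorph.addRight s).measurableEmbedding] at h1
  refine ⟨hloc f h.1, hloc g h.2.1, fun φ hφ hc => ?_⟩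
  have hsm : ContDiff ℝ ∞ fun y => φ (y - s) := hφ.comp (contDiff_id.sub contDiff_const)
  have hcs : HasCompactSupport fun y => φ (y - s) :=
    hc.comp_homeomorph (Homeomorph.subRight s)
  have ht := h.2.2 _ hsm hcs
  rw [← integral_add_right_eq_self _ s, ← integral_add_right_eq_self (fun y => deriv _ y • f y) s]
    at ht
  simpa only [deriv_comp_sub_const, add_sub_cancel_right] using ht

theorem exists_shifted_comp_add {s : ℝ}
    (hα : ∀ i ∈ Finset.Icc 1 k, Function.Periodic (S.αC i) s)
    (hJ : ∀ w, Function.Periodic (S.jacobianC w) s) {w w' : ℝ → EuclideanSpace 𝕜 (Fin m)}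
    (hw : MemLp w ⊤) (hw' : MemLp w' ⊤) (h : ∀ x, w' x = w (x + s)) (l : ℂ) (v : sobSpace m k) :
    ∃ v' : sobSpace m k, ‖v'‖ = ‖v‖ ∧
      S.shifted w' hw' l v' =ᵐ[volume] fun x => S.shifted w hw l v (x + s) := by
  obtain ⟨v', hv'⟩ := exists_wderiv_ae_eq (k := k) (d := fun i x => wderiv v i (x + s))
    (fun i hi => (hasWeakDeriv_wderiv v hi).comp_add s)
    fun i _ => (memLp_wderiv v i).comp_measurePreserving (measurePreserving_add_right volume s)
  refine ⟨v', ?_, ?_⟩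
  · change ‖v'.1‖ = ‖v.1‖
    have hn : ∀ i, ‖v'.1 i‖ = ‖v.1 i‖ := fun i => by
      refine norm_eq_of_ae_eq_comp_add (s := s) ?_
      have := hv' i (Nat.le_of_lt_succ i.2)
      rwa [wderiv_of_le _ (Nat.le_of_lt_succ i.2), wderiv_of_le _ (Nat.le_of_lt_succ i.2)] at this
    rw [Pi.norm_def, Pi.norm_def]
    exact congrArg _ (Finset.sup_congr rfl fun i _ => NNReal.eq (hn i))
  · filter_upwards [S.shifted_ae_eq w' hw' l v', ae_comp_add (S.shifted_ae_eq w hw l v) s,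
      S.linExpr_congr_ae (w := w') hv'] with x h1 h2 h3
    rw [h1, h2, h3.1, h3.2, linExpr_eq, linExpr_eq, h x, hJ]
    congr 2
    exact Finset.sum_congr rfl fun i hi => by rw [hα i hi]

/-- A translation by whole periods is an isometry that intertwines the two operators, so the
constant `C` is preserved; all translated fronts are therefore controlled at once. -/
theorem BddInv.comp_sub {w w' : ℝ → EuclideanSpace 𝕜 (Fin m)} {hw : MemLp w ⊤} {l : ℂ} {C : ℝ}
    (hb : S.BddInv w hw l C) (p : ℕ) (hw' : MemLp w' ⊤) (h : ∀ x, w' x = w (x - p * T)) :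
    S.BddInv w' hw' l C := by
  have hα : ∀ i ∈ Finset.Icc 1 k, Function.Periodic (S.αC i) (p * T) :=
    fun i hi => (S.periodic_αC hi).nat_mul p
  have hJ : ∀ w, Function.Periodic (S.jacobianC w) (p * T) :=
    fun w => (S.periodic_jacobianC w).nat_mul p
  refine ⟨fun v => ?_, fun g => ?_⟩
  · obtain ⟨v', hn, he⟩ := S.exists_shifted_comp_add hα hJ hw' hw
      (fun x => by rw [h, add_sub_cancel_right]) l v
    rw [← hn, ← norm_eq_of_ae_eq_comp_add he]
    exact hb.1 v'
  · have hm : MemLp (fun x => g (x + p * T)) 2 :=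
      (Lp.memLp g).comp_measurePreserving (measurePreserving_add_right volume _)
    obtain ⟨v, hv⟩ := hb.2 (hm.toLp _)
    obtain ⟨v', -, he⟩ := S.exists_shifted_comp_add (fun i hi => (hα i hi).neg)
      (fun w => (hJ w).neg) hw hw' (fun x => by rw [h, sub_eq_add_neg]) l v
    refine ⟨v', Lp.ext (he.trans ?_)⟩
    rw [hv]
    filter_upwards [ae_comp_add hm.coeFn_toLp (-(p * T))] with x hx
    rw [hx, neg_add_cancel_right]

end PeriodicSystem

/-! ### Gluing of bounded inverses -/

namespace PeriodicSystem

variable {𝕜 : Type*} [RCLike 𝕜] {k m : ℕ} {T : ℝ} (S : PeriodicSystem 𝕜 k m T)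

/-- A slowly varying partition of unity `η`, with cut-off functions `ψ j` equal to `1` where
`η j` does not vanish, such that the coefficients `w` and `W j` are close where `ψ j` does not
vanish. -/
structure IsGluing {ι : Type*} [Fintype ι] (w : ℝ → EuclideanSpace 𝕜 (Fin m))
    (W : ι → ℝ → EuclideanSpace 𝕜 (Fin m)) (η ψ : ι → ℝ → ℝ) (ε : ℝ) : Prop where
  nonneg : 0 ≤ ε
  le_one : ε ≤ 1
  smooth_η : ∀ j, ContDiff ℝ ∞ (η j)
  smooth_ψ : ∀ j, ContDiff ℝ ∞ (ψ j)
  abs_η : ∀ j x, |η j x| ≤ 1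
  abs_ψ : ∀ j x, |ψ j x| ≤ 1
  deriv_η : ∀ j, ∀ a ∈ Finset.Icc 1 k, ∀ x, |iteratedDeriv a (η j) x| ≤ ε
  deriv_ψ : ∀ j, ∀ a ∈ Finset.Icc 1 k, ∀ x, |iteratedDeriv a (ψ j) x| ≤ ε
  sum_eq : ∀ x, ∑ j, η j x = 1
  eq_one : ∀ j x, η j x ≠ 0 → ψ j x = 1
  close : ∀ j, ∀ᵐ x, ψ j x ≠ 0 →
    ‖matL m (S.jacobianC (W j x) x) - matL m (S.jacobianC (w x) x)‖ ≤ ε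

theorem iteratedDeriv_le_one {η : ℝ → ℝ} {ε : ℝ} (hε : ε ≤ 1) (h0 : ∀ x, |η x| ≤ 1)
    (h : ∀ a ∈ Finset.Icc 1 k, ∀ x, |iteratedDeriv a η x| ≤ ε) :
    ∀ a ≤ k, ∀ x, |iteratedDeriv a η x| ≤ 1 := by
  intro a ha x
  rcases Nat.eq_zero_or_pos a with rfl | hpos
  · simpa using h0 x
  · exact (h a (Finset.mem_Icc.2 ⟨hpos, ha⟩) x).trans hε

variable {ι : Type*} [Fintype ι] {w : ℝ → EuclideanSpace 𝕜 (Fin m)}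
  {W : ι → ℝ → EuclideanSpace 𝕜 (Fin m)} {η ψ : ι → ℝ → ℝ} {ε : ℝ}

theorem sum_ae_eq {g : L2 m} {f : ι → L2 m} (hη : ∀ x, ∑ j, η j x = 1)
    (hf : ∀ j, f j =ᵐ[volume] fun x => η j x • g x) : ∑ j, f j = g := by
  refine Lp.ext ?_
  filter_upwards [Lp.coeFn_finsetSum Finset.univ f, ae_all_iff.2 hf] with x h1 h2
  rw [h1, Finset.sum_apply, Finset.sum_congr rfl fun j _ => h2 j, ← Finset.sum_smul, hη, one_smul]

/-- If the operators `ℒ(W j) - l` have bounded inverses, then so has `ℒ(w) - l` for every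
sufficiently fine gluing `w`. -/
theorem exists_bddInv_of_isGluing (l : ℂ) {C : ℝ} (hC : 0 ≤ C) :
    ∃ ε₀ : ℝ, 0 < ε₀ ∧ ε₀ ≤ 1 ∧ ∀ (w : ℝ → EuclideanSpace 𝕜 (Fin m))
      (W : ι → ℝ → EuclideanSpace 𝕜 (Fin m)) (η ψ : ι → ℝ → ℝ) (hw : MemLp w ⊤)
      (hW : ∀ j, MemLp (W j) ⊤), S.IsGluing w W η ψ ε₀ → (∀ j, S.BddInv (W j) (hW j) l C) →
      S.BddInv w hw l (2 * Fintype.card ι * C) := by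
  obtain ⟨K, hK0, hK⟩ := S.exists_norm_shifted_leibniz_sub_le
  set c : ℝ := (Fintype.card ι : ℝ)
  have hc0 : 0 ≤ c := Nat.cast_nonneg _
  -- Chosen so that `c * C * K * ε ≤ 1 / 2`: the accumulated errors of all `c` pieces can be
  -- absorbed.
  refine ⟨min 1 (1 / (2 * (c * C * K + 1))), by positivity, min_le_left _ _,
    fun w W η ψ hw hW hg hinv => ?_⟩
  set ε := min 1 (1 / (2 * (c * C * K + 1)))
  have hsmall : c * C * K * ε ≤ 1 / 2 := by
    have h1 : ε ≤ 1 / (2 * (c * C * K + 1)) := min_le_right _ _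
    have h0 : 0 ≤ c * C * K := by positivity
    calc c * C * K * ε ≤ c * C * K * (1 / (2 * (c * C * K + 1))) := by gcongr
      _ ≤ 1 / 2 := by
        rw [mul_one_div, div_le_div_iff₀ (by positivity) (by norm_num)]
        linarith
  have hηB := fun j => iteratedDeriv_le_one hg.le_one (hg.abs_η j) (hg.deriv_η j)
  have hψB := fun j => iteratedDeriv_le_one hg.le_one (hg.abs_ψ j) (hg.deriv_ψ j)
  -- Each piece `v j = η_j u` is estimated through the inverse for `W j`. Summation leaves at most
  -- `‖u‖ / 2` on the right, and absorbing it produces the factor `2`.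
  have hbelow : ∀ u, ‖u‖ ≤ 2 * c * C * ‖S.shifted w hw l u‖ := by
    intro u
    choose v hv using fun j => exists_wderiv_leibniz (hg.smooth_η j) (hηB j) u
    choose f hf hfn using fun j => exists_smul_L2 (hg.smooth_η j).continuous (hg.abs_η j)
      (S.shifted w hw l u)
    have hvb : ∀ j, ‖v j‖ ≤ C * (‖S.shifted w hw l u‖ + K * ε * ‖u‖) := fun j => by
      refine ((hinv j).1 (v j)).trans ?_
      gcongr
      have h1 := hK w (W j) hw (hW j) l ε (η j) hg.nonneg (hg.abs_η j) (hg.deriv_η j)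
        (by
          filter_upwards [hg.close j] with x hx hne
          exact hx (by rw [hg.eq_one j x hne]; exact one_ne_zero)) u (v j) (f j) (hv j) (hf j)
      have h2 := norm_le_norm_add_norm_sub' (S.shifted (W j) (hW j) l (v j)) (f j)
      have h3 := hfn j
      linarith
    have hsum : ∑ j, v j = u := by
      refine sobSpace_ext_zero ?_
      rw [AddSubmonoidClass.coe_finsetSum, Finset.sum_apply]
      refine sum_ae_eq hg.sum_eq fun j => ?_
      have := hv j 0 (Nat.zero_le k)
      rw [wderiv_of_le _ (Nat.zero_le k)] at this
      refine this.trans (Eventually.of_forall fun x => ?_)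
      rw [leibniz_zero, wderiv_of_le _ (Nat.zero_le k)]
      rfl
    have h4 : ‖u‖ ≤ c * (C * (‖S.shifted w hw l u‖ + K * ε * ‖u‖)) := by
      calc ‖u‖ = ‖∑ j, v j‖ := by rw [hsum]
        _ ≤ ∑ j, ‖v j‖ := norm_sum_le _ _
        _ ≤ ∑ _j : ι, C * (‖S.shifted w hw l u‖ + K * ε * ‖u‖) := Finset.sum_le_sum fun j _ => hvb j
        _ = _ := by rw [Finset.sum_const, Finset.card_univ, nsmul_eq_mul]
    have h5 := mul_le_mul_of_nonneg_right hsmall (norm_nonneg u)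
    nlinarith
  refine ⟨hbelow, ?_⟩
  -- The lower bound makes the range closed, so surjectivity reduces to a trivial orthogonal
  -- complement.
  have hclosed : IsClosed ((S.shifted w hw l).range : Set (L2 m)) := by
    have ha : AntilipschitzWith (2 * c * C).toNNReal (S.shifted w hw l) := by
      refine (S.shifted w hw l).antilipschitz_of_bound fun u => ?_
      rw [Real.coe_toNNReal _ (by positivity)]
      exact hbelow u
    exact ha.isClosed_range (S.shifted w hw l).uniformContinuous
  have : CompleteSpace (S.shifted w hw l).range := hclosed.completeSpace_coe
  refine LinearMap.range_eq_top.1 (Submodule.orthogonal_eq_bot_iff.1 ?_)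
  rw [Submodule.eq_bot_iff]
  intro g hgo
  choose f hf hfn using fun j => exists_smul_L2 (hg.smooth_η j).continuous (hg.abs_η j) g
  -- `p j` solves the equation for `W j` with right-hand side `η_j g`, but on the whole line. It is
  -- cut down by `ψ_j` to where `W j` is close to `w`; as `ψ_j η_j = η_j`, the right-hand side
  -- survives. The sum of the `q j` then solves the equation for `w` up to `‖g‖ / 2`, which is
  -- impossible for `g ≠ 0` orthogonal to the range.
  choose p hp using fun j => (hinv j).2 (f j)
  choose q hq using fun j => exists_wderiv_leibniz (hg.smooth_ψ j) (hψB j) (p j)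
  have hpn : ∀ j, ‖p j‖ ≤ C * ‖g‖ := fun j => by
    refine ((hinv j).1 (p j)).trans ?_
    rw [hp]
    gcongr
    simpa using hfn j
  have hqn : ∀ j, ‖S.shifted w hw l (q j) - f j‖ ≤ K * ε * (C * ‖g‖) := fun j => by
    refine (hK (W j) w (hW j) hw l ε (ψ j) hg.nonneg (hg.abs_ψ j) (hg.deriv_ψ j)
      (by
        filter_upwards [hg.close j] with x hx hne
        rw [norm_sub_rev]
        exact hx hne) (p j) (q j) (f j) (hq j) ?_).trans
      (mul_le_mul_of_nonneg_left (hpn j) (mul_nonneg hK0 hg.nonneg))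
    rw [hp]
    filter_upwards [hf j] with x hx
    rw [hx]
    by_cases h0 : η j x = 0
    · simp [h0]
    · rw [hg.eq_one j x h0, one_smul]
  have hsum : ∑ j, f j = g := sum_ae_eq hg.sum_eq hf
  set y := S.shifted w hw l (∑ j, q j)
  have hdist : ‖g - y‖ ≤ 1 / 2 * ‖g‖ := by
    calc ‖g - y‖ = ‖∑ j, (S.shifted w hw l (q j) - f j)‖ := by
          rw [Finset.sum_sub_distrib, hsum, ← map_sum, norm_sub_rev]
      _ ≤ ∑ j, ‖S.shifted w hw l (q j) - f j‖ := norm_sum_le _ _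
      _ ≤ ∑ _j : ι, K * ε * (C * ‖g‖) := Finset.sum_le_sum fun j _ => hqn j
      _ = c * C * K * ε * ‖g‖ := by
          rw [Finset.sum_const, Finset.card_univ, nsmul_eq_mul]
          ring
      _ ≤ _ := by gcongr
  have hinner : inner ℂ y g = 0 := (Submodule.mem_orthogonal _ g).1 hgo y ⟨_, rfl⟩
  have h6 : ‖g‖ ^ 2 ≤ ‖g - y‖ * ‖g‖ := by
    calc ‖g‖ ^ 2 = ‖inner ℂ (g - y) g‖ := by
          rw [inner_sub_left, hinner, sub_zero, inner_self_eq_norm_sq_to_K]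
          simp
      _ ≤ _ := norm_inner_le_norm _ _
  by_contra hne
  have hpos : 0 < ‖g‖ := norm_pos_iff.2 hne
  nlinarith

end PeriodicSystem

/-! ### Slowly varying cut-off functions -/

/-- The transition is locally constant off `[0,1]`, and compactness handles the rest. -/
theorem exists_abs_iteratedDeriv_smoothTransition_le (a : ℕ) :
    ∃ B : ℝ, 0 ≤ B ∧ ∀ x, |iteratedDeriv a Real.smoothTransition x| ≤ B := by
  have hcont : Continuous (iteratedDeriv a Real.smoothTransition) :=
    (contDiff_iteratedDeriv Real.smoothTransition.contDiff a).continuous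
  obtain ⟨B, hB⟩ := isCompact_Icc.exists_bound_of_continuousOn (s := Icc (0 : ℝ) 1)
    hcont.continuousOn
  have hconst : ∀ (c x : ℝ), |c| ≤ 1 → Real.smoothTransition =ᶠ[𝓝 x] (fun _ => c) →
      |iteratedDeriv a Real.smoothTransition x| ≤ 1 := fun c x hc h => by
    rw [h.iteratedDeriv_eq, iteratedDeriv_const]
    split_ifs
    · exact hc
    · simp
  refine ⟨max 1 B, by positivity, fun x => ?_⟩
  rcases lt_or_ge x 0 with h0 | h0
  · refine (hconst 0 x (by simp) ?_).trans (le_max_left _ _)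
    filter_upwards [Iio_mem_nhds h0] with y hy
    exact Real.smoothTransition.zero_of_nonpos (le_of_lt hy)
  · rcases lt_or_ge 1 x with h1 | h1
    · refine (hconst 1 x (by simp) ?_).trans (le_max_left _ _)
      filter_upwards [Ioi_mem_nhds h1] with y hy
      exact Real.smoothTransition.one_of_one_le (le_of_lt hy)
    · exact (hB x ⟨h0, h1⟩).trans (le_max_right _ _)

/-- A smooth step of width `L / 8` around `(j - 1 / 2) L - c L / 8`, the outermost steps being
replaced by the constants `1` and `0`. -/
def stepFun (M : ℕ) (L c : ℝ) (j : ℕ) (x : ℝ) : ℝ :=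
  if j ≤ 1 then 1 else if M < j then 0 else
    Real.smoothTransition (8 / L * x + (c - 8 * (j - 1 / 2)))

variable {M : ℕ} {L c : ℝ} {j : ℕ}

theorem contDiff_stepFun : ContDiff ℝ ∞ (stepFun M L c j) := by
  unfold stepFun
  split_ifs
  · exact contDiff_const
  · exact contDiff_const
  · exact Real.smoothTransition.contDiff.comp ((contDiff_const.mul contDiff_id).add contDiff_const)

theorem stepFun_mem (x : ℝ) : stepFun M L c j x ∈ Icc (0 : ℝ) 1 := by
  unfold stepFun
  split_ifs
  · simp
  · simp
  · exact ⟨Real.smoothTransition.nonneg _, Real.smoothTransition.le_one _⟩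

/-- The `a`-th derivative scales like `(8 / L) ^ a`, which is at most `8 / L` for `a ≥ 1` and `L ≥
8`. -/
theorem exists_abs_iteratedDeriv_stepFun_le (k : ℕ) : ∃ B : ℝ, 0 ≤ B ∧
    ∀ (M : ℕ) (L c : ℝ) (j : ℕ), 8 ≤ L → ∀ a ∈ Finset.Icc 1 k, ∀ x,
      |iteratedDeriv a (stepFun M L c j) x| ≤ B / L := by
  choose B hB0 hB using exists_abs_iteratedDeriv_smoothTransition_le
  refine ⟨8 * ∑ a ∈ Finset.Icc 1 k, B a, by
    have := Finset.sum_nonneg fun a (_ : a ∈ Finset.Icc 1 k) => hB0 a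
    positivity, fun M L c j hL a ha x => ?_⟩
  have ha' := Finset.mem_Icc.1 ha
  have hsum : B a ≤ ∑ a ∈ Finset.Icc 1 k, B a :=
    Finset.single_le_sum (f := B) (fun a _ => hB0 a) ha
  have hL0 : 0 < L := by linarith
  have hconst : ∀ r : ℝ, |iteratedDeriv a (fun _ : ℝ => r) x| ≤
      8 * (∑ a ∈ Finset.Icc 1 k, B a) / L := fun r => by
    rw [iteratedDeriv_const, if_neg (by omega), abs_zero]
    have := (hB0 a).trans hsum
    positivity
  unfold stepFun
  split_ifs
  · exact hconst 1
  · exact hconst 0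
  · set b := c - 8 * ((j : ℝ) - 1 / 2)
    have h1 : iteratedDeriv a (fun x => Real.smoothTransition (8 / L * x + b)) =
        fun x => (8 / L) ^ a * iteratedDeriv a Real.smoothTransition (8 / L * x + b) := by
      have h2 := iteratedDeriv_comp_const_mul (n := a)
        (f := fun y => Real.smoothTransition (y + b))
        (Real.smoothTransition.contDiff.comp (contDiff_id.add contDiff_const)) (8 / L)
      rw [iteratedDeriv_comp_add_const] at h2
      exact h2
    rw [h1, abs_mul, abs_of_nonneg (by positivity)]
    have h8 : 8 / L ≤ 1 := (div_le_one hL0).2 hL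
    calc _ ≤ (8 / L) ^ 1 * B a := by
          gcongr ?_ * ?_
          · exact pow_le_pow_of_le_one (by positivity) h8 ha'.1
          · exact hB a _
      _ ≤ (8 / L) ^ 1 * ∑ a ∈ Finset.Icc 1 k, B a := by gcongr
      _ = _ := by ring

theorem sum_stepFun_sub (hM : 1 ≤ M) (x : ℝ) :
    ∑ j ∈ Finset.Icc 1 M, (stepFun M L c j x - stepFun M L c (j + 1) x) = 1 := by
  have h := Finset.sum_range_sub' (fun i => stepFun M L c (i + 1) x) M
  rw [Finset.range_eq_Ico, Finset.sum_Ico_add'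
    (fun i => stepFun M L c i x - stepFun M L c (i + 1) x) 0 M 1, zero_add] at h
  have h2 : Finset.Ico 1 (M + 1) = Finset.Icc 1 M := by
    ext i; simp only [Finset.mem_Ico, Finset.mem_Icc]; omega
  rw [← h2, h]
  have e1 : stepFun M L c 1 x = 1 := by simp [stepFun]
  have e2 : stepFun M L c (M + 1) x = 0 := by
    unfold stepFun
    rw [if_neg (by omega), if_pos (by omega)]
  rw [e1, e2, sub_zero]

theorem stepFun_of_one_lt (h1 : 1 < j) (hM : j ≤ M) (x : ℝ) :
    stepFun M L c j x = Real.smoothTransition (8 / L * x + (c - 8 * (j - 1 / 2))) := by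
  unfold stepFun
  rw [if_neg (by omega), if_neg (by omega)]

/-- Where a difference of two consecutive steps does not vanish. -/
theorem lt_of_stepFun_sub_ne_zero {c' : ℝ} (hc : |c| ≤ 2) (hc' : |c'| ≤ 2) (hj : 1 ≤ j) (hjM : j ≤ M)
    {x : ℝ} (h : stepFun M L c j x - stepFun M L c' (j + 1) x ≠ 0) :
    (j ≠ 1 → 0 < 8 / L * x + (c - 8 * (j - 1 / 2))) ∧
      (j ≠ M → 8 / L * x + (c' - 8 * (j + 1 / 2)) < 1) := by
  rw [abs_le] at hc hc'
  have hcast : ((j + 1 : ℕ) : ℝ) - 1 / 2 = j + 1 / 2 := by push_cast; ring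
  constructor
  -- In the rescaled variable consecutive transitions are `8` apart and shifted by at most `2` each.
  -- So where one step is still `0`, the next is `0` too, and where the later one is `1`, the
  -- earlier one is `1` too; either way the difference vanishes.
  · intro h1
    by_contra hn
    rw [not_lt] at hn
    refine h ?_
    rw [stepFun_of_one_lt (by omega) hjM, Real.smoothTransition.zero_of_nonpos hn]
    by_cases hjM' : j = M
    · unfold stepFun
      rw [if_neg (by omega), if_pos (by omega), sub_zero]
    · rw [stepFun_of_one_lt (by omega) (by omega), hcast,
        Real.smoothTransition.zero_of_nonpos (by linarith), sub_zero]
  · intro h1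
    by_contra hn
    rw [not_lt] at hn
    refine h ?_
    rw [stepFun_of_one_lt (j := j + 1) (by omega) (by omega), hcast,
      Real.smoothTransition.one_of_one_le hn]
    by_cases hj1 : j = 1
    · unfold stepFun
      rw [if_pos (by omega), sub_self]
    · rw [stepFun_of_one_lt (by omega) hjM,
        Real.smoothTransition.one_of_one_le (by linarith), sub_self]

/-- The shifts `2` and `-2` move both transitions outwards by `L / 4`, more than their width `L /
8`. This provides the relation between `η` and `ψ` in `IsGluing`. -/
theorem stepFun_sub_eq_one (hj : 1 ≤ j) (hjM : j ≤ M) {x : ℝ}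
    (h : stepFun M L 0 j x - stepFun M L 0 (j + 1) x ≠ 0) :
    stepFun M L 2 j x - stepFun M L (-2) (j + 1) x = 1 := by
  obtain ⟨h1, h2⟩ := lt_of_stepFun_sub_ne_zero (by simp) (by simp) hj hjM h
  have hcast : ((j + 1 : ℕ) : ℝ) - 1 / 2 = j + 1 / 2 := by push_cast; ring
  have e1 : stepFun M L 2 j x = 1 := by
    by_cases hj1 : j = 1
    · unfold stepFun
      rw [if_pos (by omega)]
    · rw [stepFun_of_one_lt (by omega) hjM, Real.smoothTransition.one_of_one_le]
      linarith [h1 hj1]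
  have e2 : stepFun M L (-2) (j + 1) x = 0 := by
    by_cases hjM' : j = M
    · unfold stepFun
      rw [if_neg (by omega), if_pos (by omega)]
    · rw [stepFun_of_one_lt (by omega) (by omega), hcast, Real.smoothTransition.zero_of_nonpos]
      linarith [h2 hjM']
  rw [e1, e2, sub_zero]

theorem abs_stepFun_sub_le {c' : ℝ} {i : ℕ} (x : ℝ) :
    |stepFun M L c j x - stepFun M L c' i x| ≤ 1 := by
  have h1 : stepFun M L c j x ∈ Icc (0 : ℝ) 1 := stepFun_mem x
  have h2 : stepFun M L c' i x ∈ Icc (0 : ℝ) 1 := stepFun_mem x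
  exact abs_sub_le_iff.2 ⟨by linarith [h1.2, h2.1], by linarith [h1.1, h2.2]⟩

theorem exists_abs_iteratedDeriv_stepFun_sub_le (k : ℕ) : ∃ B : ℝ, 0 ≤ B ∧
    ∀ (M : ℕ) (L c c' : ℝ) (j i : ℕ), 8 ≤ L → ∀ a ∈ Finset.Icc 1 k, ∀ x,
      |iteratedDeriv a (fun x => stepFun M L c j x - stepFun M L c' i x) x| ≤ B / L := by
  obtain ⟨B, hB0, hB⟩ := exists_abs_iteratedDeriv_stepFun_le k
  refine ⟨2 * B, by positivity, fun M L c c' j i hL a ha x => ?_⟩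
  have h := iteratedDeriv_sub (n := a) (x := x) (f := stepFun M L c j) (g := stepFun M L c' i)
    (contDiff_stepFun.of_le (by exact_mod_cast le_top)).contDiffAt
    (contDiff_stepFun.of_le (by exact_mod_cast le_top)).contDiffAt
  have h1 := hB M L c j hL a ha x
  have h2 := hB M L c' i hL a ha x
  change |iteratedDeriv a (stepFun M L c j - stepFun M L c' i) x| ≤ _
  rw [h]
  refine (abs_sub _ _).trans ?_
  rw [two_mul, add_div]
  exact add_le_add h1 h2

/-! ### Fronts and multifronts -/

section Fronts

variable {E : Type*} [NormedAddCommGroup E] [NormedSpace ℝ E] [CompleteSpace E]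

theorem MemSob.memLp_top {k : ℕ} (hk : 1 ≤ k) {f : ℝ → E} (h : MemSob k f) : MemLp f ⊤ := by
  obtain ⟨d, ⟨hd0, hd⟩, hm⟩ := h
  obtain ⟨C, hC, hb⟩ := HasWeakDeriv.exists_enorm_le (E := E)
  have h0 : MemLp (d 0) ⊤ := by
    refine memLp_top_of_bound (hm 0 (Nat.zero_le k)).1
      (C * (eLpNorm (d 0) 2 volume + eLpNorm (d 1) 2 volume)).toReal ?_
    filter_upwards [hb _ _ (hd 0 hk)] with x hx
    rw [← toReal_enorm]
    exact ENNReal.toReal_mono (ENNReal.mul_ne_top hC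
      (ENNReal.add_ne_top.2 ⟨(hm 0 (Nat.zero_le k)).2.ne, (hm 1 hk).2.ne⟩)) hx
  exact (memLp_congr_ae hd0).1 h0

/-- Functions tending to zero in `H^k`, `k ≥ 1`, tend to zero uniformly. -/
theorem eventually_norm_le_of_tendsto_sobNorm {k : ℕ} (hk : 1 ≤ k) {a : ℕ → ℝ → E}
    (ha : Tendsto (fun n => sobNorm k (a n)) atTop (𝓝 0)) {δ : ℝ} (hδ : 0 < δ) :
    ∀ᶠ n in atTop, ∀ᵐ x, ‖a n x‖ ≤ δ := by
  obtain ⟨C, hC, hb⟩ := HasWeakDeriv.exists_enorm_le (E := E)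
  obtain ⟨r, hr0, hr⟩ := exists_pos_mul_add_self_le hC hδ
  filter_upwards [ha.eventually_lt_const hr0] with n hn
  simp only [sobNorm, iInf_lt_iff] at hn
  obtain ⟨d, hd, hlt⟩ := hn
  have hle : ∀ i ≤ k, eLpNorm (d i) 2 volume ≤ r := fun i hi => by
    refine le_trans ?_ hlt.le
    have h1 : eLpNorm (d i) 2 volume ^ 2 ≤ ∑ i ∈ Finset.range (k + 1), eLpNorm (d i) 2 volume ^ 2 :=
      Finset.single_le_sum (f := fun i => eLpNorm (d i) 2 volume ^ 2) (fun _ _ => zero_le)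
        (Finset.mem_range.2 (by omega))
    calc eLpNorm (d i) 2 volume = (eLpNorm (d i) 2 volume ^ 2) ^ (1 / 2 : ℝ) := by
          rw [← ENNReal.rpow_natCast, ← ENNReal.rpow_mul]
          norm_num
      _ ≤ _ := by gcongr
  filter_upwards [hb _ _ (hd.2 0 hk), hd.1] with x hx h0
  rw [← h0]
  have h3 : ‖d 0 x‖ₑ ≤ ENNReal.ofReal δ := by
    refine hx.trans (le_trans ?_ hr)
    gcongr
    · exact hle 0 (Nat.zero_le k)
    · exact hle 1 hk
  rw [← ofReal_norm] at h3
  exact (ENNReal.ofReal_le_ofReal_iff hδ.le).1 h3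

theorem MemSob.exists_norm_le_of_le_abs {k : ℕ} (hk : 1 ≤ k) {f : ℝ → E} (h : MemSob k f) {δ : ℝ}
    (hδ : 0 < δ) : ∃ R : ℝ, ∀ᵐ x, R ≤ |x| → ‖f x‖ ≤ δ := by
  obtain ⟨d, ⟨hd0, hd⟩, hm⟩ := h
  obtain ⟨R, hR⟩ := (hd 0 hk).exists_norm_le_of_le_abs (hm 0 (Nat.zero_le k)) (hm 1 hk) hδ
  refine ⟨R, ?_⟩
  filter_upwards [hR, hd0] with x hx h0
  rwa [← h0]

theorem IsFront.exists_norm_sub_le {k : ℕ} (hk : 1 ≤ k) {T : ℝ} {χm χp : ℝ → ℝ}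
    (hχ : IsFrontCutoff χm χp) {Z vm vp : ℝ → E} (h : IsFront k T χm χp Z vm vp) {δ : ℝ}
    (hδ : 0 < δ) : ∃ R : ℝ, ∀ᵐ x, (R ≤ x → ‖Z x - vp x‖ ≤ δ) ∧ (x ≤ -R → ‖Z x - vm x‖ ≤ δ) := by
  obtain ⟨R₁, h₁⟩ := h.tail_p.exists_norm_le_of_le_abs hk hδ
  obtain ⟨R₂, h₂⟩ := h.tail_m.exists_norm_le_of_le_abs hk hδ
  refine ⟨max 1 (max R₁ R₂), ?_⟩
  filter_upwards [h₁, h₂] with x hx1 hx2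
  constructor
  · intro hx
    have h0 : χm x = 0 := by
      by_contra hne
      have : x < 1 := hχ.supp_m (subset_tsupport _ hne)
      linarith [(le_max_left _ _).trans hx]
    have h1 : χp x = 1 := by linarith [hχ.sum_eq x]
    have := hx1 ((((le_max_left _ _).trans (le_max_right _ _)).trans hx).trans (le_abs_self x))
    rwa [h1, one_smul] at this
  · intro hx
    have h0 : χp x = 0 := by
      by_contra hne
      have : -1 < x := hχ.supp_p (subset_tsupport _ hne)
      linarith [le_max_left 1 (max R₁ R₂)]
    have h1 : χm x = 1 := by linarith [hχ.sum_eq x]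
    have := hx2 (((le_max_right _ _).trans (le_max_right _ _)).trans
      ((le_neg.2 hx).trans (neg_le_abs x)))
    rwa [h1, one_smul] at this

/-- Consecutive fronts are close to each other between their interfaces. -/
theorem exists_norm_front_sub_le {k : ℕ} (hk : 1 ≤ k) {T : ℝ} {χm χp : ℝ → ℝ}
    (hχ : IsFrontCutoff χm χp) {M : ℕ} {Z vm vp : ℕ → ℝ → E}
    (hfront : ∀ j ∈ Finset.Icc 1 M, IsFront k T χm χp (Z j) (vm j) (vp j))
    (hmatch : ∀ j ∈ Finset.Ico 1 M, vp j =ᵐ[volume] vm (j + 1)) {δ : ℝ} (hδ : 0 < δ) :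
    ∃ R : ℝ, 0 ≤ R ∧ ∀ n : ℕ, ∀ᵐ x, ∀ j ∈ Finset.Ico 1 M, R ≤ x - j * n * T →
      x - (j + 1 : ℕ) * n * T ≤ -R →
      ‖Z j (x - j * n * T) - Z (j + 1) (x - (j + 1 : ℕ) * n * T)‖ ≤ δ := by
  have h : ∀ j, ∃ R : ℝ, j ∈ Finset.Icc 1 M →
      ∀ᵐ x, (R ≤ x → ‖Z j x - vp j x‖ ≤ δ / 2) ∧ (x ≤ -R → ‖Z j x - vm j x‖ ≤ δ / 2) := fun j => by
    by_cases hj : j ∈ Finset.Icc 1 M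
    · obtain ⟨R, hR⟩ := (hfront j hj).exists_norm_sub_le hk hχ (half_pos hδ)
      exact ⟨R, fun _ => hR⟩
    · exact ⟨0, fun h => absurd h hj⟩
  choose R hR using h
  have hRle : ∀ j ∈ Finset.Icc 1 M, R j ≤ ∑ j ∈ Finset.Icc 1 M, |R j| := fun j hj =>
    (le_abs_self _).trans (Finset.single_le_sum (f := fun j => |R j|) (fun _ _ => abs_nonneg _) hj)
  refine ⟨∑ j ∈ Finset.Icc 1 M, |R j|, Finset.sum_nonneg fun _ _ => abs_nonneg _, fun n => ?_⟩
  rw [ae_all_iff]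
  intro j
  by_cases hj : j ∈ Finset.Ico 1 M
  swap
  · exact Eventually.of_forall fun x h => absurd h hj
  have hj' := Finset.mem_Ico.1 hj
  have hj1 : j ∈ Finset.Icc 1 M := Finset.mem_Icc.2 ⟨hj'.1, hj'.2.le⟩
  have hj2 : j + 1 ∈ Finset.Icc 1 M := Finset.mem_Icc.2 ⟨by omega, hj'.2⟩
  filter_upwards [PeriodicSystem.ae_comp_add (hR j hj1) (-(j * n * T)),
    PeriodicSystem.ae_comp_add (hR (j + 1) hj2) (-((j + 1 : ℕ) * n * T)),
    PeriodicSystem.ae_comp_add (hmatch j hj) (-((j + 1 : ℕ) * n * T))] with x h1 h2 h3 _ hx1 hx2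
  simp only [← sub_eq_add_neg] at h1 h2 h3
  have e1 := h1.1 ((hRle j hj1).trans hx1)
  have e2 := h2.2 (hx2.trans (neg_le_neg (hRle (j + 1) hj2)))
  -- The two translations differ by `n` periods, so both fronts are compared with the same periodic
  -- state.
  have hper : vp j (x - j * n * T) = vp j (x - (j + 1 : ℕ) * n * T) := by
    have := (hfront j hj1).per_p.1.sub_nat_mul_eq (x := x - j * n * T) n
    rw [← this]
    congr 1
    push_cast
    ring
  rw [hper, h3] at e1
  calc _ = ‖(Z j (x - j * n * T) - vm (j + 1) (x - (j + 1 : ℕ) * n * T)) -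
        (Z (j + 1) (x - (j + 1 : ℕ) * n * T) - vm (j + 1) (x - (j + 1 : ℕ) * n * T))‖ := by
        congr 1; abel
    _ ≤ δ / 2 + δ / 2 := (norm_sub_le _ _).trans (add_le_add e1 e2)
    _ = δ := add_halves δ

end Fronts

/-! ### Uniform estimates for the concatenation. -/

section Concatenation

variable {E : Type*} [NormedAddCommGroup E]

theorem memLp_top_comp_sub {f : ℝ → E} (hf : MemLp f ⊤) (s : ℝ) : MemLp (fun x => f (x - s)) ⊤ :=
  hf.comp_measurePreserving (measurePreserving_sub_right volume s)

variable [NormedSpace ℝ E]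

/-- Around its `j`-th interface, the concatenation is close to the `j`-th front. -/
theorem norm_concatenation_sub_le {M n j : ℕ} {T R δ x : ℝ} {χ : ℕ → ℝ → ℝ}
    (hcut : IsMultiCutoff M T n χ) {Z : ℕ → ℝ → E} (hR : 0 ≤ R) (hδ : 0 ≤ δ)
    (hL : 8 * R + 8 ≤ n * T) (hj : j ∈ Finset.Icc 1 M)
    (hclose : ∀ j ∈ Finset.Ico 1 M, R ≤ x - j * n * T → x - (j + 1 : ℕ) * n * T ≤ -R →
      ‖Z j (x - j * n * T) - Z (j + 1) (x - (j + 1 : ℕ) * n * T)‖ ≤ δ)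
    (hx : stepFun M (n * T) 2 j x - stepFun M (n * T) (-2) (j + 1) x ≠ 0) :
    ‖concatenation M T n χ Z x - Z j (x - j * n * T)‖ ≤ δ := by
  have hj' := Finset.mem_Icc.1 hj
  set L : ℝ := n * T with hLdef
  have hL0 : 0 < L := by linarith
  obtain ⟨hlow, hupp⟩ := lt_of_stepFun_sub_ne_zero (by norm_num) (by norm_num) hj'.1 hj'.2 hx
  -- The widened cut-off lives between the start `(j - 1/2 - 1/4) L` of its lower transition and the
  -- end `(j + 1/2 + 1/4 + 1/8) L` of its upper one.
  have hlow' : j ≠ 1 → (j - 3 / 4) * L < x := fun h => by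
    have h1 := mul_pos hL0 (hlow h)
    have h2 : L * (8 / L * x + (2 - 8 * ((j : ℝ) - 1 / 2))) = 8 * (x - (j - 3 / 4) * L) := by
      field_simp
      ring
    rw [h2] at h1
    linarith
  have hupp' : j ≠ M → x < (j + 7 / 8) * L := fun h => by
    have h1 := mul_lt_mul_of_pos_left (hupp h) hL0
    have h2 : L * (8 / L * x + (-2 - 8 * ((j : ℝ) + 1 / 2))) = 8 * x - (8 * j + 6) * L := by
      field_simp
      ring
    rw [h2] at h1
    linarith
  have hmem : ∀ i : ℕ, (i : ℝ) * n * T = i * L := fun i => mul_assoc _ _ _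
  -- Here only `i = j` and its neighbours can contribute. For a neighbour, `x` lies between the two
  -- interfaces at distance at least `R` from both; the tightest gap is `L / 8`, whence the
  -- condition `8 * R + 8 ≤ L`.
  have hterm : ∀ i ∈ Finset.Icc 1 M, χ i x ≠ 0 →
      ‖Z i (x - i * n * T) - Z j (x - j * n * T)‖ ≤ δ := by
    intro i hi hne
    have hi' := Finset.mem_Icc.1 hi
    have hil : i ≠ 1 → (i - 1 / 2) * L - 1 < x := fun h => by
      have : ((i : ℝ) - 1 / 2) * n * T - 1 < x := hcut.supp_lower i hi h (subset_tsupport _ hne)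
      rwa [mul_assoc] at this
    have hiu : i ≠ M → x < (i + 1 / 2) * L + 1 := fun h => by
      have : x < ((i : ℝ) + 1 / 2) * n * T + 1 := hcut.supp_upper i hi h (subset_tsupport _ hne)
      rwa [mul_assoc] at this
    rcases lt_trichotomy i j with hij | rfl | hij
    · have h1 := hlow' (by omega)
      have h2 := hiu (by omega)
      have hji : j = i + 1 := by
        by_contra hne'
        have : ((i + 2 : ℕ) : ℝ) ≤ j := Nat.cast_le.2 (by omega)
        push_cast at this
        have := mul_le_mul_of_nonneg_right this hL0.le
        nlinarith
      subst hji
      refine hclose i (Finset.mem_Ico.2 ⟨hi'.1, by omega⟩) ?_ ?_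
      · rw [hmem]; push_cast at h1; linarith
      · rw [hmem]; push_cast; linarith
    · simpa using hδ
    · have h1 := hupp' (by omega)
      have h2 := hil (by omega)
      have hji : i = j + 1 := by
        by_contra hne'
        have : ((j + 2 : ℕ) : ℝ) ≤ i := Nat.cast_le.2 (by omega)
        push_cast at this
        have := mul_le_mul_of_nonneg_right this hL0.le
        nlinarith
      subst hji
      rw [norm_sub_rev]
      refine hclose j (Finset.mem_Ico.2 ⟨hj'.1, by omega⟩) ?_ ?_
      · rw [hmem]; push_cast at h2; linarith
      · rw [hmem]; push_cast; linarith
  have e : concatenation M T n χ Z x - Z j (x - j * n * T) =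
      ∑ i ∈ Finset.Icc 1 M, χ i x • (Z i (x - i * n * T) - Z j (x - j * n * T)) := by
    simp only [smul_sub, Finset.sum_sub_distrib, concatenation]
    rw [← Finset.sum_smul, hcut.sum_eq, one_smul]
  rw [e]
  calc _ ≤ ∑ i ∈ Finset.Icc 1 M, χ i x * δ := by
        refine (norm_sum_le _ _).trans (Finset.sum_le_sum fun i hi => ?_)
        rw [norm_smul, Real.norm_of_nonneg (hcut.mem i hi x).1]
        by_cases hne : χ i x = 0
        · rw [hne, zero_mul, zero_mul]
        · exact mul_le_mul_of_nonneg_left (hterm i hi hne) (hcut.mem i hi x).1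
    _ = δ := by rw [← Finset.sum_mul, hcut.sum_eq, one_mul]

theorem memLp_top_concatenation {M n : ℕ} {T : ℝ} {χ : ℕ → ℝ → ℝ} (hcut : IsMultiCutoff M T n χ)
    {Z : ℕ → ℝ → E} (hZ : ∀ j ∈ Finset.Icc 1 M, MemLp (Z j) ⊤) :
    MemLp (concatenation M T n χ Z) ⊤ := by
  refine memLp_finsetSum _ fun j hj => ?_
  have hm := memLp_top_comp_sub (hZ j hj) (j * n * T)
  refine hm.of_le_mul (c := 1)
    ((hcut.smooth j hj).continuous.aestronglyMeasurable.smul hm.1) (Eventually.of_forall fun x => ?_)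
  rw [norm_smul, Real.norm_of_nonneg (hcut.mem j hj x).1]
  gcongr
  exact (hcut.mem j hj x).2

end Concatenation

/-! ### Uniform resolvent bounds for the multifronts. -/

namespace PeriodicSystem

variable {𝕜 : Type*} [RCLike 𝕜] {k m : ℕ} {T : ℝ} (S : PeriodicSystem 𝕜 k m T)

theorem BddInv.mono {w : ℝ → EuclideanSpace 𝕜 (Fin m)} {hw : MemLp w ⊤} {l : ℂ} {C C' : ℝ}
    (h : S.BddInv w hw l C) (hC : C ≤ C') : S.BddInv w hw l C' :=
  ⟨fun v => (h.1 v).trans (by gcongr), h.2⟩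

/-- The cut-off functions at the interfaces glue the translated fronts to the multifront. -/
theorem eventually_isGluing {M : ℕ} (hM : 1 ≤ M)
    {χm χp : ℝ → ℝ} (hχ : IsFrontCutoff χm χp)
    {Z vm vp : ℕ → ℝ → EuclideanSpace 𝕜 (Fin m)}
    (hfront : ∀ j ∈ Finset.Icc 1 M, IsFront k T χm χp (Z j) (vm j) (vp j))
    (hmatch : ∀ j ∈ Finset.Ico 1 M, vp j =ᵐ[volume] vm (j + 1))
    {N : ℕ} {χ : ℕ → ℕ → ℝ → ℝ} (hcut : ∀ n ≥ N, IsMultiCutoff M T n (χ n))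
    {a u : ℕ → ℝ → EuclideanSpace 𝕜 (Fin m)}
    (ha_lim : Tendsto (fun n => sobNorm k (a n)) atTop (𝓝 0))
    (hu : ∀ n ≥ N, u n = fun x => a n x + concatenation M T n (χ n) Z x) {ε : ℝ} (hε : 0 < ε)
    (hε1 : ε ≤ 1) :
    ∀ᶠ n in atTop, S.IsGluing (u n) (fun (j : Finset.Icc 1 M) x => Z j (x - (j : ℕ) * n * T))
      (fun j x => stepFun M (n * T) 0 j x - stepFun M (n * T) 0 (j + 1) x)
      (fun j x => stepFun M (n * T) 2 j x - stepFun M (n * T) (-2) (j + 1) x) ε := by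
  have hbd : ∃ R : ℝ, ∀ j ∈ Finset.Icc 1 M, ∀ᵐ x, ‖Z j x‖ ≤ R := by
    have h : ∀ j, ∃ R : ℝ, j ∈ Finset.Icc 1 M → ∀ᵐ x, ‖Z j x‖ ≤ R := fun j => by
      by_cases hj : j ∈ Finset.Icc 1 M
      · obtain ⟨R, hR⟩ := exists_ae_norm_le (hfront j hj).bounded
        exact ⟨R, fun _ => hR⟩
      · exact ⟨0, fun h => absurd h hj⟩
    choose R hR using h
    refine ⟨∑ j ∈ Finset.Icc 1 M, |R j|, fun j hj => ?_⟩
    filter_upwards [hR j hj] with x hx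
    exact hx.trans ((le_abs_self _).trans
      (Finset.single_le_sum (f := fun j => |R j|) (fun _ _ => abs_nonneg _) hj))
  obtain ⟨R₀, hR₀⟩ := hbd
  -- The distance from `u n` to the front is split evenly between `a n` and the concatenation.
  -- Keeping the total below `1` as well as `δ` keeps `u n` in the ball of radius `R₀ + 1`, where
  -- the Jacobian is uniformly continuous.
  obtain ⟨δ, hδ, hJ⟩ := S.exists_norm_jacobianC_sub_le (R₀ + 1) hε
  set δ' := min δ 1 / 2 with hδ'
  have hδ'0 : 0 < δ' := by positivity
  have hδ1 : δ' + δ' ≤ δ := by rw [hδ', add_halves]; exact min_le_left _ _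
  have hδ2 : δ' + δ' ≤ 1 := by rw [hδ', add_halves]; exact min_le_right _ _
  obtain ⟨R, hR, hclose⟩ := exists_norm_front_sub_le S.order_pos hχ hfront hmatch hδ'0
  obtain ⟨B, hB0, hB⟩ := exists_abs_iteratedDeriv_stepFun_sub_le k
  have hlim : Tendsto (fun n : ℕ => (n : ℝ) * T) atTop atTop :=
    tendsto_natCast_atTop_atTop.atTop_mul_const S.period_pos
  filter_upwards [eventually_ge_atTop N, hlim.eventually_ge_atTop (8 * R + 8),
    hlim.eventually_ge_atTop (B / ε), eventually_norm_le_of_tendsto_sobNorm S.order_pos ha_lim hδ'0]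
    with n hnN hL hLB ha
  have hL8 : 8 ≤ (n : ℝ) * T := by linarith
  have hBL : B / ((n : ℝ) * T) ≤ ε := by
    rw [div_le_iff₀ (by linarith)]
    rwa [div_le_iff₀ hε, mul_comm] at hLB
  refine ⟨hε.le, hε1, fun j => contDiff_stepFun.sub contDiff_stepFun,
    fun j => contDiff_stepFun.sub contDiff_stepFun, fun j x => abs_stepFun_sub_le x,
    fun j x => abs_stepFun_sub_le x, fun j b hb x => (hB M _ _ _ _ _ hL8 b hb x).trans hBL,
    fun j b hb x => (hB M _ _ _ _ _ hL8 b hb x).trans hBL, fun x => ?_, fun j x hx => ?_,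
    fun j => ?_⟩
  · rw [Finset.sum_coe_sort (Finset.Icc 1 M)
      (fun j => stepFun M (n * T) 0 j x - stepFun M (n * T) 0 (j + 1) x)]
    exact sum_stepFun_sub hM x
  · have hj := Finset.mem_Icc.1 j.2
    exact stepFun_sub_eq_one hj.1 hj.2 hx
  · filter_upwards [ha, hclose n, ae_comp_add (hR₀ j j.2) (-((j : ℕ) * n * T))]
      with x hax hcx hZx hne
    rw [← sub_eq_add_neg] at hZx
    have h1 := norm_concatenation_sub_le (hcut n hnN) hR hδ'0.le hL j.2 hcx hne
    have h2 : ‖u n x - Z j (x - (j : ℕ) * n * T)‖ ≤ δ' + δ' := by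
      rw [hu n hnN, add_sub_assoc]
      exact (norm_add_le _ _).trans (add_le_add hax h1)
    have h3 : ‖u n x‖ ≤ R₀ + 1 := by
      have := norm_le_norm_add_norm_sub' (u n x) (Z j (x - (j : ℕ) * n * T))
      linarith
    rw [norm_sub_rev] at h2
    exact hJ _ _ x (by linarith) h3 (h2.trans hδ1)

/-- A point in the resolvent sets of all the fronts lies in the resolvent sets of the multifronts
with sufficiently distant interfaces, with uniformly bounded resolvents. -/
theorem exists_eventually_isResolvent {M : ℕ} (hM : 1 ≤ M)
    {χm χp : ℝ → ℝ} (hχ : IsFrontCutoff χm χp)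
    {Z vm vp : ℕ → ℝ → EuclideanSpace 𝕜 (Fin m)}
    (hfront : ∀ j ∈ Finset.Icc 1 M, IsFront k T χm χp (Z j) (vm j) (vp j))
    (hmatch : ∀ j ∈ Finset.Ico 1 M, vp j =ᵐ[volume] vm (j + 1))
    {N : ℕ} {χ : ℕ → ℕ → ℝ → ℝ} (hcut : ∀ n ≥ N, IsMultiCutoff M T n (χ n))
    {a u : ℕ → ℝ → EuclideanSpace 𝕜 (Fin m)} (ha : ∀ n ≥ N, MemSob k (a n))
    (ha_lim : Tendsto (fun n => sobNorm k (a n)) atTop (𝓝 0))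
    (hu : ∀ n ≥ N, u n = fun x => a n x + concatenation M T n (χ n) Z x) {l : ℂ}
    (hl : ∀ j ∈ Finset.Icc 1 M, l ∈ resolventSet (S.lin (Z j))) :
    ∃ C : ℝ, ∀ᶠ n in atTop, ∃ R : L2 m →L[ℂ] L2 m, IsResolvent (S.lin (u n)) l R ∧ ‖R‖ ≤ C := by
  choose C hC0 hC using fun j : Finset.Icc 1 M =>
    S.exists_bddInv_of_mem_resolventSet (hfront j j.2).bounded (hl j j.2)
  -- The sum serves as a common constant for all fronts.
  have hsum0 : 0 ≤ ∑ j, C j := Finset.sum_nonneg fun j _ => hC0 j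
  obtain ⟨ε, hε, hε1, hglue⟩ := S.exists_bddInv_of_isGluing (ι := Finset.Icc 1 M) l hsum0
  refine ⟨2 * Fintype.card (Finset.Icc 1 M) * ∑ j, C j, ?_⟩
  filter_upwards [eventually_ge_atTop N,
    S.eventually_isGluing hM hχ hfront hmatch hcut ha_lim hu hε hε1] with n hn hg
  have hZ : ∀ j ∈ Finset.Icc 1 M, MemLp (Z j) ⊤ := fun j hj => (hfront j hj).bounded
  have hun : MemLp (u n) ⊤ := by
    rw [hu n hn]
    exact ((ha n hn).memLp_top S.order_pos).add (memLp_top_concatenation (hcut n hn) hZ)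
  refine BddInv.exists_isResolvent S (by positivity)
    (hglue (u n) _ _ _ hun (fun j => memLp_top_comp_sub (hZ j j.2) _) hg fun j => ?_)
  refine (BddInv.comp_sub S (hC j) (j * n) _ fun x => ?_).mono S
    (Finset.single_le_sum (fun j _ => hC0 j) (Finset.mem_univ j))
  rw [Nat.cast_mul]

end PeriodicSystem

end Multifront

end

/-! ### Spectral stability of the multifronts. -/

theorem mainTheorem5 {𝕜 : Type*} [RCLike 𝕜] {k m : ℕ} {T : ℝ}
    (S : Multifront.PeriodicSystem 𝕜 k m T)
    (M : ℕ) (hM : 2 ≤ M)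
    (χm χp : ℝ → ℝ) (hχ : Multifront.IsFrontCutoff χm χp)
    (Z vm vp : ℕ → ℝ → EuclideanSpace 𝕜 (Fin m))
    (hfront : ∀ j ∈ Finset.Icc 1 M, Multifront.IsFront k T χm χp (Z j) (vm j) (vp j))
    (hmatch : ∀ j ∈ Finset.Ico 1 M, vp j =ᵐ[volume] vm (j + 1))
    (hsol : ∀ j ∈ Finset.Icc 1 M, S.IsSolution (Z j))
    (hnondeg : ∀ j ∈ Finset.Icc 1 M, S.Nondegenerate (Z j))
    (hstable : ∀ j ∈ Finset.Icc 1 M, S.StronglySpectrallyStable (Z j))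
    (N : ℕ) (χ : ℕ → ℕ → ℝ → ℝ)
    (hcut : ∀ n ≥ N, Multifront.IsMultiCutoff M T n (χ n))
    (hcut_bound : ∃ B : ℝ, ∀ n ≥ N, ∀ j ∈ Finset.Icc 1 M, ∀ i ≤ k, ∀ x,
      |iteratedDeriv i (χ n j) x| ≤ B)
    (a u : ℕ → ℝ → EuclideanSpace 𝕜 (Fin m))
    (ha : ∀ n ≥ N, Multifront.MemSob k (a n))
    (ha_lim : Tendsto (fun n => Multifront.sobNorm k (a n)) atTop (𝓝 0))
    (hu : ∀ n ≥ N, u n = fun x => a n x + Multifront.concatenation M T n (χ n) Z x)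
    (hu_sol : ∀ n ≥ N, S.IsSolution (u n))
    (K : Set ℂ) (hK : IsCompact K)
    (hspec : ∀ n ≥ N, Multifront.spec (S.lin (u n)) ∩ {l : ℂ | 0 ≤ l.re} ⊆ K) :
    ∃ N₁ : ℕ, N ≤ N₁ ∧ ∀ n ≥ N₁,
      Multifront.spec (S.lin (u n)) ⊆ {l : ℂ | l.re < 0} ∧
      ((∃ δ : ℝ, 0 < δ ∧
          Bornology.IsBounded (Multifront.spec (S.lin (u n)) ∩ {l : ℂ | -δ ≤ l.re})) →
        S.StronglySpectrallyStable (u n)) := by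
  have hsub : ∀ l ∈ K ∩ {l : ℂ | 0 ≤ l.re}, ∀ j ∈ Finset.Icc 1 M,
      l ∈ Multifront.resolventSet (S.lin (Z j)) := by
    intro l hl j hj
    by_contra hn
    obtain ⟨ϱ, hϱ, hs⟩ := hstable j hj
    have h1 : l.re ≤ -ϱ := hs hn
    have h2 : 0 ≤ l.re := hl.2
    linarith
  -- `K` itself may reach into the left half-plane, where the fronts can have spectrum, so only its
  -- part with `Re ≥ 0` is used.
  have hK' : IsCompact (K ∩ {l : ℂ | 0 ≤ l.re}) :=
    hK.inter_right (isClosed_le continuous_const Complex.continuous_re)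
  obtain ⟨N₀, hN₀⟩ := eventually_atTop.1 (Multifront.eventually_subset_resolventSet
    (A := fun n => S.lin (u n)) hK' fun l hl =>
      S.exists_eventually_isResolvent (by omega) hχ hfront hmatch hcut ha ha_lim hu (hsub l hl))
  refine ⟨max N N₀, le_max_left _ _, fun n hn => ?_⟩
  have hneg : Multifront.spec (S.lin (u n)) ⊆ {l : ℂ | l.re < 0} := by
    intro l hl
    by_contra hre
    have hre' : 0 ≤ l.re := not_lt.1 hre
    exact hl (hN₀ n ((le_max_right _ _).trans hn)
      ⟨hspec n ((le_max_left _ _).trans hn) ⟨hl, hre'⟩, hre'⟩)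
  refine ⟨hneg, ?_⟩
  rintro ⟨δ, hδ, hb⟩
  exact Multifront.exists_spec_subset_of_isBounded hneg hδ hb
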